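/- Let $m>0$, $r_0>2m$, $\delta>0$, and identify $\Sigma=(r_0,\infty)\times\mathbb S^2$ with the exterior region $\{x\in\mathbb R^3: r=|x|>r_0\}$; write $\omega_i=x^i/r$, $\Upsilon=1-2m/r$, $S_r=\{|x|=r\}$, and for a scalar $\phi$ put $\phi_{\ell=1,i}(r)=\int_{\mathbb S^2}\phi(r\omega)\,\omega_i\,d\omega$, where $d\omega$ is the unit round area element. Let $g$ be a $C^2$ Riemannian metric and $k$ a $C^1$ symmetric $2$-tensor on $\Sigma$ such that $g=\hat a^2dr^2+\gamma$ (so that $\partial_r\perp_g TS_r$, $\hat a>0$, and $\gamma$ is the induced metric of the spheres $S_r$). Let $N=\hat a^{-1}\partial_r$ be the unit normal of the spheres, $(e_1,e_2)$ an orthonormal frame of $TS_r$ with $(N,e_1,e_2)$ positively oriented, and $$\theta_{ab}=g(\nabla_aN,e_b),\quad \Theta_{ab}=k(e_a,e_b),\quad \Xi_a=k(N,e_a),\quad \Pi=k(N,N),$$ let $\hat\theta$ be the traceless part of $\theta$, let $K$ be the Gauss curvature of $(S_r,\gamma)$, let $\not{\mathrm{div}},\not{\mathrm{curl}},\not\Delta,\not{\mathrm{tr}}$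 be the operators of $(S_r,\gamma)$, and $$\mu=-\not\Delta\log\hat a+K-\tfrac14(\not{\mathrm{tr}}\,\theta)^2,\qquad \widecheck{\mathrm{tr}\theta}=\not{\mathrm{tr}}\,\theta-2\Upsilon^{1/2}r^{-1}.$$ Assume the following properties of the data constructed in the Main Theorem. (1) $(g,k)$ solves the vacuum constraint equations $\mathrm{div}\,k-\nabla\mathrm{tr}\,k=0$, $R_g+(\mathrm{tr}\,k)^2-|k|^2=0$. (2) Gauge conditions: $\mu$ is constant on each sphere $S_r$ (that is, $\mu_{\ell\ge1}=0$), and $\not{\mathrm{div}}\,\Xi=0$. (3) Decay: with $\gamma^{(0)}=r^2\gamma_{\mathbb S^2}$, its covariant derivative $\not\nabla^{(0)}$, and pointwise norms taken with respect to $\gamma^{(0)}$, on all of $\Sigma$, $$|(r\not\nabla^{(0)})^{j}(\hat a-\Upsilon^{-1/2})|+|(r\not\nabla^{(0)})^{j}(\gamma-\gamma^{(0)})|=O(r^{-1-\delta})\quad(j\le2),$$ $$|(r\not\nabla^{(0)})^{j}(\widecheck{\mathrm{tr}\theta},\hat\theta,\Theta,\Xi,\Pi)|=O(r^{-2-\delta})\quad(j\le1).$$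 (4) Conditions at infinity: there are $c,b,a\in\mathbb R^3$ such that, for $i=1,2,3$, $$\lim_{r\to\infty}r^3(\widecheck{\mathrm{tr}\theta})_{\ell=1,i}=c_i,\qquad \lim_{r\to\infty}r^2(\not{\mathrm{tr}}\,\Theta)_{\ell=1,i}=b_i,\qquad \lim_{r\to\infty}r^4(\not{\mathrm{curl}}\,\Xi)_{\ell=1,i}=a_i$$ (in the Main Theorem $c$ and $a$ are prescribed and $b=0$). Then the limits defining the ADM charges $$\mathbf E=\tfrac1{16\pi}\lim_{r\to\infty}\int_{S_r}\sum_{i,j}(\partial_ig_{ij}-\partial_jg_{ii})\,\omega_j\,dA,\qquad \mathbf P_i=\tfrac1{8\pi}\lim_{r\to\infty}\int_{S_r}\sum_j(k_{ij}-\mathrm{tr}_\delta k\,g_{ij})\,\omega_j\,dA,$$ $$\mathbf J_i=\tfrac1{8\pi}\lim_{r\to\infty}\int_{S_r}\sum_{j,l,n}\epsilon_{iln}x^l(k_{nj}-\mathrm{tr}_\delta k\,g_{nj})\,\omega_j\,dA,$$ $$\mathbf C_i=\tfrac1{16\pi m}\lim_{r\to\infty}\int_{S_r}\sum_j\Big(x^i\sum_l(\partial_lg_{lj}-\partial_jg_{ll})-(g_{ij}-\delta_{ij})+\delta_{ij}\sum_l(g_{ll}-1)\Big)\omega_j\,dA$$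 (Cartesian components, Euclidean area element $dA$ and trace $\mathrm{tr}_\delta$) exist, and for $i=1,2,3$ $$\mathbf E=m,\qquad \mathbf C_i=-\frac1{8\pi m}\lim_{r\to\infty}r^3(\widecheck{\mathrm{tr}\theta})_{\ell=1,i},\qquad \mathbf P_i=-\frac1{8\pi}\lim_{r\to\infty}r^2(\not{\mathrm{tr}}\,\Theta)_{\ell=1,i},\qquad \mathbf J_i=\frac1{8\pi}\lim_{r\to\infty}r^4(\not{\mathrm{curl}}\,\Xi)_{\ell=1,i}.$$ -/

import Mathlib

open MeasureTheory Filter Topology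

noncomputable section

namespace HorizontalConstraint

/-! ## Cartesian tensor calculus on an exterior region of Euclidean space

All tensor fields are given by their components in the Cartesian coordinates `x⁰, x¹, x²`.
A scalar is a function `E3 → ℝ`, a vector field or a 1-form is a function `E3 → Fin 3 → ℝ`, and a
2-tensor is a function `E3 → Matrix (Fin 3) (Fin 3) ℝ`. -/

/-- Euclidean 3-space. -/
abbrev E3 : Type := EuclideanSpace ℝ (Fin 3)

/-- The exterior region `{|x| > r₀}`, that is `(r₀, ∞) × S²` in polar coordinates. -/
def exterior (r₀ : ℝ) : Set E3 := {x | r₀ < ‖x‖}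

/-- The partial derivative `∂ᵢ f`. -/
def pd (i : Fin 3) (f : E3 → ℝ) (x : E3) : ℝ := fderiv ℝ f x (EuclideanSpace.single i 1)

/-- `ωᵢ = xⁱ / r`, with `r = |x|`. -/
def omega (x : E3) (i : Fin 3) : ℝ := x i / ‖x‖

/-- The Kronecker symbol. -/
def kron (i j : Fin 3) : ℝ := if i = j then 1 else 0

/-- The Levi-Civita symbol `ε_{ijk}`, with `ε₀₁₂ = 1`. -/
def eps (i j k : Fin 3) : ℝ :=
  (((j : ℕ) : ℝ) - ((i : ℕ) : ℝ)) * (((k : ℕ) : ℝ) - ((i : ℕ) : ℝ)) *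
    (((k : ℕ) : ℝ) - ((j : ℕ) : ℝ)) / 2

section Metric

variable (g : E3 → Matrix (Fin 3) (Fin 3) ℝ)

/-- The Christoffel symbol `Γᵏᵢⱼ` of `g`. -/
def christoffel (x : E3) (k i j : Fin 3) : ℝ :=
  (1 / 2) * ∑ l, (g x)⁻¹ k l *
    (pd i (fun y => g y j l) x + pd j (fun y => g y i l) x - pd l (fun y => g y i j) x)

/-- The Ricci tensor `Rᵢⱼ` of `g`. -/
def ricci (x : E3) (i j : Fin 3) : ℝ :=
  ∑ k, (pd k (fun y => christoffel g y k i j) x - pd j (fun y => christoffel g y k i k) x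
    + ∑ l, (christoffel g x k k l * christoffel g x l i j
      - christoffel g x k j l * christoffel g x l i k))

/-- The scalar curvature `R_g`. -/
def scalarCurvature (x : E3) : ℝ := ∑ i, ∑ j, (g x)⁻¹ i j * ricci g x i j

/-- The covariant derivative `∇ₗ kᵢⱼ` of a covariant 2-tensor. -/
def covTwo (k : E3 → Matrix (Fin 3) (Fin 3) ℝ) (x : E3) (l i j : Fin 3) : ℝ :=
  pd l (fun y => k y i j) x - ∑ a, christoffel g x a l i * k x a j
    - ∑ a, christoffel g x a l j * k x i a

/-- The covariant derivative `∇ᵢ ψⱼ` of a 1-form. -/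
def covOne (ψ : E3 → Fin 3 → ℝ) (x : E3) (i j : Fin 3) : ℝ :=
  pd i (fun y => ψ y j) x - ∑ a, christoffel g x a i j * ψ x a

/-- The covariant derivative `∇_X Y` of a vector field along a vector field. -/
def covVec (X Y : E3 → Fin 3 → ℝ) (x : E3) (k : Fin 3) : ℝ :=
  ∑ i, X x i * (pd i (fun y => Y y k) x + ∑ j, christoffel g x k i j * Y x j)

/-- The trace `tr_g k`. -/
def trace (k : E3 → Matrix (Fin 3) (Fin 3) ℝ) (x : E3) : ℝ := ∑ i, ∑ j, (g x)⁻¹ i j * k x i j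

/-- The square norm `|k|²_g`. -/
def normSq (k : E3 → Matrix (Fin 3) (Fin 3) ℝ) (x : E3) : ℝ :=
  ∑ i, ∑ j, ∑ a, ∑ b, (g x)⁻¹ i a * (g x)⁻¹ j b * k x i j * k x a b

/-- The vacuum Einstein constraint equations at the point `x`:
`div k - ∇ tr k = 0` and `R_g + (tr k)² - |k|² = 0`. -/
def ConstraintAt (k : E3 → Matrix (Fin 3) (Fin 3) ℝ) (x : E3) : Prop :=
  (∀ j, ∑ l, ∑ i, (g x)⁻¹ l i * covTwo g k x l i j - pd j (trace g k) x = 0) ∧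
  scalarCurvature g x + trace g k x ^ 2 - normSq g k x = 0

/-! ## The foliation by the spheres `S_r = {|x| = r}` and its horizontal quantities

Sums over an orthonormal frame `e₁, e₂` of the horizontal space `N^⊥ = T S_r` are written as
contractions with `γ^{ij} = g^{ij} - Nⁱ Nʲ = ∑ₐ eₐⁱ eₐʲ`. Horizontal tensors are represented by
their Cartesian components, which vanish when contracted with `N`. -/

/-- The lapse `â = |∇r|_g⁻¹ = (N r)⁻¹`. -/
def lapse (x : E3) : ℝ :=
  (Real.sqrt (∑ i, ∑ j, (g x)⁻¹ i j * omega x i * omega x j))⁻¹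

/-- The outward `g`-unit normal `N` of the spheres (components `Nⁱ`). -/
def normalUp (x : E3) (i : Fin 3) : ℝ := lapse g x * ∑ j, (g x)⁻¹ i j * omega x j

/-- The 1-form `g(N, ·) = â dr` (components `Nᵢ`). -/
def normalDown (x : E3) (i : Fin 3) : ℝ := lapse g x * omega x i

/-- The `g`-orthogonal projection to the horizontal space, `Πⁱⱼ = δⁱⱼ - Nⁱ Nⱼ`. -/
def hproj (x : E3) (i j : Fin 3) : ℝ := kron i j - normalUp g x i * normalDown g x j

/-- The induced metric `γᵢⱼ = gᵢⱼ - Nᵢ Nⱼ` of the spheres. -/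
def hmetric (x : E3) (i j : Fin 3) : ℝ := g x i j - normalDown g x i * normalDown g x j

/-- `γ^{ij} = g^{ij} - Nⁱ Nʲ`. -/
def hinv (x : E3) (i j : Fin 3) : ℝ := (g x)⁻¹ i j - normalUp g x i * normalUp g x j

/-- The horizontal volume form `∈^{ij}`, for the orientation in which `(N, e₁, e₂)` is positive. -/
def hvol (x : E3) (i j : Fin 3) : ℝ :=
  (Real.sqrt (g x).det)⁻¹ * ∑ l, eps l i j * normalDown g x l

/-- The horizontal restriction of a covariant 2-tensor, with components `T(eₐ, e_b)`. -/
def hrestrict (T : E3 → Matrix (Fin 3) (Fin 3) ℝ) (x : E3) (i j : Fin 3) : ℝ :=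
  ∑ a, ∑ b, hproj g x a i * hproj g x b j * T x a b

/-- The horizontal gradient of a scalar. -/
def hgrad (f : E3 → ℝ) (x : E3) (i : Fin 3) : ℝ := ∑ a, hproj g x a i * pd a f x

/-- The horizontal divergence `δ^{ab} ∇_a ψ_b` of a horizontal 1-form. -/
def hdiv (ψ : E3 → Fin 3 → ℝ) (x : E3) : ℝ := ∑ i, ∑ j, hinv g x i j * covOne g ψ x i j

/-- The horizontal curl `∈^{ab} ∇_a ψ_b` of a horizontal 1-form. -/
def hcurl (ψ : E3 → Fin 3 → ℝ) (x : E3) : ℝ := ∑ i, ∑ j, hvol g x i j * covOne g ψ x i j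

/-- The horizontal Laplacian of a scalar, i.e. the Laplacian of the induced metric `γ`. -/
def hlap (f : E3 → ℝ) (x : E3) : ℝ := hdiv g (hgrad g f) x

/-- The second fundamental form `θ_{ab} = g(∇_a N, e_b)` of the spheres. -/
def theta (x : E3) (i j : Fin 3) : ℝ :=
  hrestrict g (fun y => Matrix.of (covOne g (normalDown g) y)) x i j

/-- The trace of `θ`. -/
def trTheta (x : E3) : ℝ := ∑ i, ∑ j, hinv g x i j * theta g x i j

/-- The traceless part of `θ`. -/
def thetaHat (x : E3) (i j : Fin 3) : ℝ := theta g x i j - (1 / 2) * trTheta g x * hmetric g x i j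

/-- The horizontal connection: the horizontal projection of `∇_X Y`. -/
def hcov (X Y : E3 → Fin 3 → ℝ) (x : E3) (k : Fin 3) : ℝ := ∑ c, hproj g x k c * covVec g X Y x c

/-- The commutator `[X, Y]` of two vector fields. -/
def bracket (X Y : E3 → Fin 3 → ℝ) (x : E3) (k : Fin 3) : ℝ :=
  ∑ i, (X x i * pd i (fun y => Y y k) x - Y x i * pd i (fun y => X y k) x)

/-- The curvature `R(X, Y) Z` of the horizontal connection. On vector fields tangent to the spheres
the horizontal connection is the Levi-Civita connection of `γ`. -/
def hcurv (X Y Z : E3 → Fin 3 → ℝ) (x : E3) (k : Fin 3) : ℝ :=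
  hcov g X (hcov g Y Z) x k - hcov g Y (hcov g X Z) x k - hcov g (bracket X Y) Z x k

/-- The horizontal projection of the coordinate field `∂ᵢ`. -/
def hframe (i : Fin 3) (x : E3) (k : Fin 3) : ℝ := hproj g x k i

/-- The Gauss curvature `K` of the spheres with the induced metric `γ`:
`2 K = ∑_{a,b} γ(R(eₐ, e_b) e_b, eₐ)`. -/
def gaussCurvature (x : E3) : ℝ :=
  (1 / 2) * ∑ i, ∑ j, ∑ k, ∑ l, hinv g x i l * hinv g x j k *
    ∑ p, ∑ q, g x p q * hcurv g (hframe g i) (hframe g j) (hframe g k) x p * hframe g l x q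

/-- The mass aspect function `μ = -Δ(log â) + K - ¼ (tr θ)²`. -/
def massAspect (x : E3) : ℝ :=
  -hlap g (fun y => Real.log (lapse g y)) x + gaussCurvature g x - (1 / 4) * trTheta g x ^ 2

variable (k : E3 → Matrix (Fin 3) (Fin 3) ℝ)

/-- `Θ_{ab} = k(eₐ, e_b)`. -/
def bigTheta (x : E3) (i j : Fin 3) : ℝ := hrestrict g k x i j

/-- The trace of `Θ`. -/
def trBigTheta (x : E3) : ℝ := ∑ i, ∑ j, hinv g x i j * bigTheta g k x i j

/-- `Ξ_a = k(N, eₐ)`. -/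
def bigXi (x : E3) (i : Fin 3) : ℝ := ∑ a, ∑ b, normalUp g x a * k x a b * hproj g x b i

/-- `Π = k(N, N)`. -/
def bigPi (x : E3) : ℝ := ∑ a, ∑ b, normalUp g x a * normalUp g x b * k x a b

end Metric

/-! ## Spherical integrals, modes and weighted bounds -/

/-- The integral of `f` over the sphere `S_r` against the area element of the unit round sphere,
`∫_{S²} f(r ω) dω`. -/
def sphereInt (f : E3 → ℝ) (r : ℝ) : ℝ :=
  ∫ ω : Metric.sphere (0 : E3) 1, f (r • (ω : E3)) ∂((volume : Measure E3).toSphere)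

/-- The component `f_{ℓ=1,i}(r) = ∫_{S²} f(r ω) ωᵢ dω`. -/
def ellOne (i : Fin 3) (f : E3 → ℝ) (r : ℝ) : ℝ := sphereInt (fun x => f x * omega x i) r

/-- The part `f_{ℓ≥1}`, i.e. `f` minus its mean over the round sphere through `x`. -/
def ellGeOne (f : E3 → ℝ) (x : E3) : ℝ := f x - (4 * Real.pi)⁻¹ * sphereInt f ‖x‖

/-- `Υ = 1 - 2m/r`. -/
def upsilon (m : ℝ) (x : E3) : ℝ := 1 - 2 * m / ‖x‖

/-- `tr θ` minus its Schwarzschild value `2 Υ^{1/2} / r`. -/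
def trThetaCheck (m : ℝ) (g : E3 → Matrix (Fin 3) (Fin 3) ℝ) (x : E3) : ℝ :=
  trTheta g x - 2 * Real.sqrt (upsilon m x) / ‖x‖

/-- `â` minus its Schwarzschild value `Υ^{-1/2}`. -/
def lapseCheck (m : ℝ) (g : E3 → Matrix (Fin 3) (Fin 3) ℝ) (x : E3) : ℝ :=
  lapse g x - (Real.sqrt (upsilon m x))⁻¹

/-- The round metric `γ⁽⁰⁾ = r² γ_{S²}`, in Cartesian components. As an endomorphism it is also the
Euclidean projection to the tangent space of the spheres. -/
def roundMetric (x : E3) (i j : Fin 3) : ℝ := kron i j - omega x i * omega x j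

/-- The covariant derivative with respect to the round metric `γ⁽⁰⁾` of a covariant tensor of rank
`n` on the spheres: the tangential projection, in all indices, of the Euclidean derivative. The new
index comes first. -/
def roundDeriv {n : ℕ} (U : E3 → (Fin n → Fin 3) → ℝ) (x : E3) (I : Fin (n + 1) → Fin 3) : ℝ :=
  ∑ J : Fin (n + 1) → Fin 3,
    (∏ a, roundMetric x (I a) (J a)) * pd (J 0) (fun y => U y (Fin.tail J)) x

/-- `HorizontalO r₀ s q U` says that `|(r ∇⁽⁰⁾)^j U|_{γ⁽⁰⁾} = O(r^{-q})` on `{r > r₀}` for all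
`j ≤ s`, for a covariant tensor `U` on the spheres. -/
def HorizontalO (r₀ : ℝ) : (s : ℕ) → (q : ℝ) → {n : ℕ} → (E3 → (Fin n → Fin 3) → ℝ) → Prop
  | 0, q, _, U => ∃ C : ℝ, ∀ x ∈ exterior r₀, ∀ I, |U x I| ≤ C * ‖x‖ ^ (-q)
  | s + 1, q, _, U =>
      (∃ C : ℝ, ∀ x ∈ exterior r₀, ∀ I, |U x I| ≤ C * ‖x‖ ^ (-q)) ∧
        HorizontalO r₀ s (q + 1) (roundDeriv U)

/-- A scalar, as a tensor of rank 0. -/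
def tensor0 (f : E3 → ℝ) (x : E3) (_ : Fin 0 → Fin 3) : ℝ := f x

/-- A 1-form, as a tensor of rank 1. -/
def tensor1 (ψ : E3 → Fin 3 → ℝ) (x : E3) (I : Fin 1 → Fin 3) : ℝ := ψ x (I 0)

/-- A covariant 2-tensor, as a tensor of rank 2. -/
def tensor2 (T : E3 → Fin 3 → Fin 3 → ℝ) (x : E3) (I : Fin 2 → Fin 3) : ℝ := T x (I 0) (I 1)

/-! ## The ADM charges

`tr_δ k = ∑ₖ kₖₖ`, the Euclidean unit normal of `S_r` is `ω`, and the Euclidean area element of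
`S_r` is `r² dω`. A charge is defined if the limit exists. -/

/-- `E` is the ADM energy of `g`. -/
def HasADMEnergy (g : E3 → Matrix (Fin 3) (Fin 3) ℝ) (E : ℝ) : Prop :=
  Tendsto (fun r : ℝ => 1 / (16 * Real.pi) * (r ^ 2 * sphereInt (fun x =>
    ∑ i, ∑ j, (pd i (fun y => g y i j) x - pd j (fun y => g y i i) x) * omega x j) r))
    atTop (𝓝 E)

/-- `P` is the `i`-th component of the ADM linear momentum of `(g, k)`. -/
def HasADMLinearMomentum (g k : E3 → Matrix (Fin 3) (Fin 3) ℝ) (i : Fin 3) (P : ℝ) : Prop :=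
  Tendsto (fun r : ℝ => 1 / (8 * Real.pi) * (r ^ 2 * sphereInt (fun x =>
    ∑ j, (k x i j - (∑ a, k x a a) * g x i j) * omega x j) r))
    atTop (𝓝 P)

/-- `J` is the `i`-th component of the ADM angular momentum of `(g, k)`. -/
def HasADMAngularMomentum (g k : E3 → Matrix (Fin 3) (Fin 3) ℝ) (i : Fin 3) (J : ℝ) : Prop :=
  Tendsto (fun r : ℝ => 1 / (8 * Real.pi) * (r ^ 2 * sphereInt (fun x =>
    ∑ j, ∑ l, ∑ n, eps i l n * x l * (k x n j - (∑ a, k x a a) * g x n j) * omega x j) r))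
    atTop (𝓝 J)

/-- `C` is the `i`-th component of the ADM center of mass of `g`, for the mass `m`. -/
def HasADMCenterOfMass (m : ℝ) (g : E3 → Matrix (Fin 3) (Fin 3) ℝ) (i : Fin 3) (C : ℝ) : Prop :=
  Tendsto (fun r : ℝ => 1 / (16 * Real.pi * m) * (r ^ 2 * sphereInt (fun x =>
    ∑ j, (x i * (∑ l, (pd l (fun y => g y l j) x - pd j (fun y => g y l l) x))
      - ((g x i j - kron i j) - kron i j * ∑ l, (g x l l - kron l l))) * omega x j) r))
    atTop (𝓝 C)

/-! ## The class of initial data -/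

/-- The exterior initial data sets `(g, k)` on `(r₀, ∞) × S²` with mass `m`, decay exponent `δ` and
prescribed `ℓ = 1` asymptotics `c`, `b`, `a`:

* `g = â² dr² + γ` and `(g, k)` solves the vacuum constraint equations;
* the foliation by the spheres `|x| = r` satisfies the gauge conditions `μ_{ℓ≥1} = 0` and
  `ν = div Ξ = 0`;
* `(g, k)` is close to Schwarzschild data of mass `m`: the metric coefficients up to two horizontal
  derivatives with rate `r^{-1-δ}`, the second fundamental forms `θ` and `k` up to one horizontal
  derivative with rate `r^{-2-δ}`;
* the `ℓ = 1` modes of `tr θ`, `tr Θ` and `curl Ξ` have the prescribed behavior at infinity. -/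
structure IsGaugedExteriorData (m r₀ δ : ℝ) (c b a : Fin 3 → ℝ)
    (g k : E3 → Matrix (Fin 3) (Fin 3) ℝ) : Prop where
  contDiff_g : ∀ i j, ContDiffOn ℝ 2 (fun x => g x i j) (exterior r₀)
  contDiff_k : ∀ i j, ContDiffOn ℝ 1 (fun x => k x i j) (exterior r₀)
  posDef_g : ∀ x ∈ exterior r₀, (g x).PosDef
  symm_k : ∀ x ∈ exterior r₀, (k x).IsSymm
  radial_g : ∀ x ∈ exterior r₀, ∀ i, ∑ j, g x i j * omega x j = lapse g x ^ 2 * omega x i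
  constraint : ∀ x ∈ exterior r₀, ConstraintAt g k x
  gauge_mu : ∀ x ∈ exterior r₀, ellGeOne (massAspect g) x = 0
  gauge_nu : ∀ x ∈ exterior r₀, hdiv g (bigXi g k) x = 0
  bound_lapse : HorizontalO r₀ 2 (1 + δ) (tensor0 (lapseCheck m g))
  bound_metric : HorizontalO r₀ 2 (1 + δ) (tensor2 fun x i j => hmetric g x i j - roundMetric x i j)
  bound_trTheta : HorizontalO r₀ 1 (2 + δ) (tensor0 (trThetaCheck m g))
  bound_thetaHat : HorizontalO r₀ 1 (2 + δ) (tensor2 (thetaHat g))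
  bound_bigTheta : HorizontalO r₀ 1 (2 + δ) (tensor2 (bigTheta g k))
  bound_bigXi : HorizontalO r₀ 1 (2 + δ) (tensor1 (bigXi g k))
  bound_bigPi : HorizontalO r₀ 1 (2 + δ) (tensor0 (bigPi g k))
  lim_trTheta : ∀ i, Tendsto (fun r : ℝ => r ^ 3 * ellOne i (trThetaCheck m g) r) atTop (𝓝 (c i))
  lim_trBigTheta : ∀ i, Tendsto (fun r : ℝ => r ^ 2 * ellOne i (trBigTheta g k) r) atTop (𝓝 (b i))
  lim_curlXi : ∀ i,
    Tendsto (fun r : ℝ => r ^ 4 * ellOne i (hcurl g (bigXi g k)) r) atTop (𝓝 (a i))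

end HorizontalConstraint

end

/-! Since `∂_r` is orthogonal to the spheres, the matrix `g` has `ω` as an eigenvector with
eigenvalue `â²`. Hence the horizontal projection is the Euclidean tangential one (`hproj_eq`), and
each flux integrand becomes an exact pointwise expression in `â, γ, θ, Ξ, Θ, Π`. The limits then
follow by counting powers of `r`.

Energy and center. The decay assumptions give no direct control of radial derivatives.
Differentiating `g ω = â² ω` and expressing `∂_r γ` through `θ` turns the energy integrand into
`2â²/r + (∑ γᵢᵢ)/r - 2â ∑ θᵢᵢ` (`adm_integrand`), in which `∂_r â` has cancelled. Up to a product of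
two small factors, `∑ θᵢᵢ` equals `½ tr θ ∑ γᵢᵢ` (`sum_theta_eq`). Expanding around Schwarzschild,
the terms linear in the lapse perturbation cancel to leading order, and `r` times the integrand is
`2(Υ⁻¹ - 1) - (∑ γᵢᵢ - 2) - 2r (tr θ - 2Υ^{1/2}/r) + O(r^{-2-δ})` (`decays_adm`). In the energy only
the first term survives and gives `m`. The center of mass integrand is `ωᵢ` times `r` times the
energy integrand plus `∑ γᵢᵢ - 2` (`center_integrand`), so the trace of `γ` drops out exactly. The
radial term integrates to zero against `ωᵢ`, and the `ℓ = 1` mode of `tr θ` is left.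

Momenta. Splitting `k` into `Π, Ξ, Θ` shows that the linear momentum integrand and `-tr Θ ωᵢ` are
both `O(r^{-2-δ})`, so their `r²`-weighted integrals have the same limit. In the angular momentum
the radial part is killed by `ε_{iln} ω_l ω_n = 0`, leaving `r â ε_{iln} ω_l Ξ_n`. Integration by
parts along rotation fields (`sphereInt_curl`) turns this into the `ℓ = 1` mode of the Euclidean
radial curl, which differs from the horizontal curl only by the factor `â / √det g = 1 +
O(r^{-1-δ})` (`hcurl_eq`, `decays_density`). -/

noncomputable section

namespace HorizontalConstraint

/-! ## Integrals over coordinate spheres -/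

/-- The unit round sphere. -/
abbrev S2 : Type := Metric.sphere (0 : E3) 1

/-- The round area measure of the unit sphere. -/
abbrev sigma : Measure S2 := (volume : Measure E3).toSphere

theorem isOpen_exterior (r₀ : ℝ) : IsOpen (exterior r₀) := isOpen_lt continuous_const continuous_norm

theorem norm_smul_sphere {r : ℝ} (hr : 0 ≤ r) (w : S2) : ‖r • (w : E3)‖ = r := by
  rw [norm_smul, Real.norm_of_nonneg hr, norm_eq_of_mem_sphere, mul_one]

theorem smul_sphere_mem_exterior {r₀ r : ℝ} (h0 : 0 ≤ r) (hr : r₀ < r) (w : S2) :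
    r • (w : E3) ∈ exterior r₀ := by
  simpa only [exterior, Set.mem_ofPred_eq, norm_smul_sphere h0] using hr

theorem sigma_univ : sigma.real Set.univ = 4 * Real.pi := by
  rw [Measure.toSphere_real_apply_univ, Measure.real, EuclideanSpace.volume_ball_fin_three]
  rw [ENNReal.toReal_mul, ← ENNReal.ofReal_pow zero_le_one, one_pow, ENNReal.toReal_ofReal zero_le_one,
    ENNReal.toReal_ofReal (by positivity)]
  simp
  ring

/-- The action of a linear isometry on the unit sphere. -/
def sphereMap (L : E3 ≃ₗᵢ[ℝ] E3) (w : S2) : S2 := ⟨L w, by simp⟩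

theorem continuous_sphereMap (L : E3 ≃ₗᵢ[ℝ] E3) : Continuous (sphereMap L) := by
  unfold sphereMap
  fun_prop

-- The measure of a set in the sphere is a multiple of the Lebesgue measure of the cone over it. The
-- cone over a preimage under an isometry is the preimage of the cone, and Lebesgue measure is
-- invariant under isometries.
open scoped Pointwise in
theorem measurePreserving_sphereMap (L : E3 ≃ₗᵢ[ℝ] E3) :
    MeasurePreserving (sphereMap L) sigma sigma := by
  refine ⟨(continuous_sphereMap L).measurable, ?_⟩
  ext s hs
  have hm := (continuous_sphereMap L).measurable
  rw [Measure.map_apply hm hs, Measure.toSphere_apply' _ (hm hs), Measure.toSphere_apply' _ hs]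
  congr 1
  rw [← L.measurePreserving.measure_preimage_emb L.toHomeomorph.measurableEmbedding
    (Set.Ioo (0 : ℝ) 1 • (Subtype.val '' s))]
  congr 1
  ext x
  simp only [Set.mem_smul, Set.mem_image, Set.mem_preimage]
  constructor
  · rintro ⟨t, ht, _, ⟨w, hw, rfl⟩, rfl⟩
    exact ⟨t, ht, _, ⟨_, hw, rfl⟩, by simp [sphereMap]⟩
  · rintro ⟨t, ht, _, ⟨w, hw, rfl⟩, (hx : t • (w : E3) = L x)⟩
    refine ⟨t, ht, _, ⟨sphereMap L.symm w, ?_, rfl⟩, ?_⟩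
    · simpa [sphereMap] using hw
    · apply L.injective
      rw [← hx]
      simp [sphereMap]

theorem integral_sphereMap (L : E3 ≃ₗᵢ[ℝ] E3) (f : S2 → ℝ) :
    ∫ w, f (sphereMap L w) ∂sigma = ∫ w, f w ∂sigma := by
  refine (measurePreserving_sphereMap L).integral_comp ?_ f
  refine (continuous_sphereMap L).measurableEmbedding fun a b h => ?_
  have := congrArg Subtype.val h
  exact Subtype.ext (L.injective this)

theorem sphereInt_congr {f h : E3 → ℝ} {r : ℝ} (hr : 0 ≤ r) (H : ∀ x, ‖x‖ = r → f x = h x) :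
    sphereInt f r = sphereInt h r :=
  integral_congr_ae (Eventually.of_forall fun w => H _ (norm_smul_sphere hr w))

theorem integrable_sphere {f : E3 → ℝ} {r₀ r : ℝ} (hf : ContinuousOn f (exterior r₀))
    (h0 : 0 ≤ r) (hr : r₀ < r) : Integrable (fun w : S2 => f (r • (w : E3))) sigma := by
  have hc : Continuous (fun w : S2 => f (r • (w : E3))) :=
    hf.comp_continuous (by fun_prop) (smul_sphere_mem_exterior h0 hr)
  exact hc.integrable_of_hasCompactSupport (HasCompactSupport.of_compactSpace _)

theorem sphereInt_add {f h : E3 → ℝ} {r₀ r : ℝ} (hf : ContinuousOn f (exterior r₀))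
    (hh : ContinuousOn h (exterior r₀)) (h0 : 0 ≤ r) (hr : r₀ < r) :
    sphereInt (fun x => f x + h x) r = sphereInt f r + sphereInt h r :=
  integral_add (integrable_sphere hf h0 hr) (integrable_sphere hh h0 hr)

theorem sphereInt_radial_mul (φ : ℝ → ℝ) (f : E3 → ℝ) {r : ℝ} (hr : 0 ≤ r) :
    sphereInt (fun x => φ ‖x‖ * f x) r = φ r * sphereInt f r := by
  simp only [sphereInt, norm_smul_sphere hr]
  exact integral_const_mul _ _

theorem sphereInt_const (c r : ℝ) : sphereInt (fun _ => c) r = 4 * Real.pi * c := by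
  simp only [sphereInt, integral_const, sigma_univ, smul_eq_mul]

/-- The antipodal map preserves the measure and reverses the sign of `ωᵢ`. This removes the
Schwarzschild part of the center of mass integrand. -/
theorem sphereInt_omega (i : Fin 3) (r : ℝ) : sphereInt (fun x => omega x i) r = 0 := by
  have h := integral_sphereMap (LinearIsometryEquiv.neg ℝ) (fun w => omega (r • (w : E3)) i)
  have h2 : ∀ w : S2, omega (r • (sphereMap (LinearIsometryEquiv.neg ℝ) w : E3)) i
      = - omega (r • (w : E3)) i := by
    intro w
    simp [sphereMap, omega, neg_div]
  simp only [h2, integral_neg] at h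
  simp only [sphereInt]
  linarith

/-- The sphere has total mass `4π`, so the sup bound integrates to `r^{p-q}`. No measurability is
needed, because the norm bound on the Bochner integral holds for any integrand. -/
theorem tendsto_pow_mul_sphereInt {f : E3 → ℝ} {p : ℕ} {q : ℝ} (hpq : (p : ℝ) < q)
    (hf : f =O[Bornology.cobounded E3] fun x => ‖x‖ ^ (-q)) :
    Tendsto (fun r : ℝ => r ^ p * sphereInt f r) atTop (𝓝 0) := by
  obtain ⟨C, hC⟩ := hf.bound
  rw [← comap_norm_atTop, eventually_comap] at hC
  have hb : ∀ᶠ r : ℝ in atTop,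
      ‖r ^ p * sphereInt f r‖ ≤ C * (4 * Real.pi) * r ^ (-(q - p)) := by
    filter_upwards [hC, eventually_gt_atTop 0] with r hr h0
    have h1 : ‖sphereInt f r‖ ≤ C * r ^ (-q) * sigma.real Set.univ := by
      refine norm_integral_le_of_norm_le_const (Eventually.of_forall fun w => ?_)
      have := hr (r • (w : E3)) (norm_smul_sphere h0.le w)
      rwa [norm_smul_sphere h0.le, Real.norm_of_nonneg (Real.rpow_nonneg h0.le _)] at this
    rw [sigma_univ] at h1
    have h2 : r ^ (-(q - p)) = r ^ p * r ^ (-q) := by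
      rw [← Real.rpow_natCast r p, ← Real.rpow_add h0]; congr 1; ring
    rw [norm_mul, Real.norm_of_nonneg (pow_nonneg h0.le p), h2]
    calc r ^ p * ‖sphereInt f r‖ ≤ r ^ p * (C * r ^ (-q) * (4 * Real.pi)) := by gcongr
      _ = _ := by ring
  refine squeeze_zero_norm' hb ?_
  simpa using (tendsto_rpow_neg_atTop (sub_pos.2 hpq)).const_mul (C * (4 * Real.pi))

/-! ## Rotations -/

/-- The infinitesimal rotation in the coordinate plane of `a` and `b`. -/
def rotGen (a b : Fin 3) (x : E3) : E3 :=
  x a • EuclideanSpace.single b 1 - x b • EuclideanSpace.single a 1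

/-- The rotation by the angle `t` in the coordinate plane of `a` and `b`. -/
def rotMap (a b : Fin 3) (t : ℝ) : E3 →ₗ[ℝ] E3 where
  toFun x := x + (Real.cos t - 1) • (x a • EuclideanSpace.single a 1 + x b • EuclideanSpace.single b 1)
    + Real.sin t • rotGen a b x
  map_add' x y := by simp only [rotGen, PiLp.add_apply, add_smul, smul_add, smul_sub]; abel
  map_smul' c x := by
    simp only [rotGen, PiLp.smul_apply, smul_eq_mul, RingHom.id_apply]
    module

theorem norm_rotMap {a b : Fin 3} (hab : a ≠ b) (t : ℝ) (x : E3) : ‖rotMap a b t x‖ = ‖x‖ := by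
  rw [EuclideanSpace.norm_eq, EuclideanSpace.norm_eq]
  congr 1
  have := Real.sin_sq_add_cos_sq t
  fin_cases a <;> fin_cases b <;> first
    | exact absurd rfl hab
    | (simp [rotMap, rotGen, Fin.sum_univ_three]
       first
        | linear_combination (x 0 ^ 2 + x 1 ^ 2) * this
        | linear_combination (x 0 ^ 2 + x 2 ^ 2) * this
        | linear_combination (x 1 ^ 2 + x 2 ^ 2) * this)

/-- `rotMap` as a linear isometry. -/
def rotEquiv {a b : Fin 3} (hab : a ≠ b) (t : ℝ) : E3 ≃ₗᵢ[ℝ] E3 :=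
  LinearIsometry.toLinearIsometryEquiv ⟨rotMap a b t, norm_rotMap hab t⟩ rfl

/-- The rotations are the flow of `rotGen`. Evaluating the generator at the moved point makes the
later `t`-derivative a fixed function composed with a rotation, hence bounded uniformly in `t`. -/
theorem hasDerivAt_rotMap {a b : Fin 3} (hab : a ≠ b) (t : ℝ) (x : E3) :
    HasDerivAt (fun t => rotMap a b t x) (rotGen a b (rotMap a b t x)) t := by
  have h1 : HasDerivAt (fun t => rotMap a b t x)
      ((-Real.sin t) • (x a • EuclideanSpace.single a 1 + x b • EuclideanSpace.single b 1)
        + Real.cos t • rotGen a b x) t := by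
    have hc := ((Real.hasDerivAt_cos t).sub_const 1).smul_const
      (x a • EuclideanSpace.single a (1:ℝ) + x b • EuclideanSpace.single b (1:ℝ) : E3)
    have hs := (Real.hasDerivAt_sin t).smul_const (rotGen a b x)
    exact (hc.const_add x).add hs
  convert h1 using 1
  ext i
  have := Real.sin_sq_add_cos_sq t
  fin_cases a <;> fin_cases b <;> fin_cases i <;> simp_all [rotMap, rotGen] <;> ring

/-- The integral of a rotational derivative over a sphere vanishes. -/
theorem sphereInt_rot {f : E3 → ℝ} {r₀ r : ℝ} (hf : ContDiffOn ℝ 1 f (exterior r₀))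
    (h0 : 0 < r) (hr : r₀ < r) {a b : Fin 3} (hab : a ≠ b) :
    sphereInt (fun x => omega x a * pd b f x - omega x b * pd a f x) r = 0 := by
  have hd : ∀ x ∈ exterior r₀, HasFDerivAt f (fderiv ℝ f x) x := fun x hx =>
    ((hf.differentiableOn one_ne_zero).differentiableAt
      ((isOpen_exterior r₀).mem_nhds hx)).hasFDerivAt
  have hcf : ContinuousOn (fderiv ℝ f) (exterior r₀) :=
    hf.continuousOn_fderiv_of_isOpen (isOpen_exterior r₀) le_rfl
  have hmem := fun w : S2 => smul_sphere_mem_exterior h0.le hr w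
  set G : S2 → ℝ := fun w => fderiv ℝ f (r • (w : E3)) (r • rotGen a b w) with hG
  have hGc : Continuous G := by
    have h1 : Continuous fun w : S2 => fderiv ℝ f (r • (w : E3)) :=
      hcf.comp_continuous (by fun_prop) hmem
    have h2 : Continuous fun w : S2 => r • rotGen a b (w : E3) := by
      unfold rotGen; fun_prop
    exact h1.clm_apply h2
  obtain ⟨C, hC⟩ := (isCompact_range hGc).isBounded.exists_norm_le
  have hfc : Continuous fun w : S2 => f (r • (w : E3)) :=
    hf.continuousOn.comp_continuous (by fun_prop) hmem
  -- Differentiation of `t ↦ ∫ f(r R_t ω) dω` under the integral sign. The constant `C` dominates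
  -- for every `t`, since `G` is continuous on the compact sphere and `R_t` only moves its argument.
  have key := hasDerivAt_integral_of_dominated_loc_of_deriv_le (μ := sigma) (s := Set.univ)
    (F := fun (t : ℝ) (w : S2) => f (r • (sphereMap (rotEquiv hab t) w : E3)))
    (F' := fun t w => G (sphereMap (rotEquiv hab t) w)) (x₀ := 0) (bound := fun _ => C)
    univ_mem
    (Eventually.of_forall fun t =>
      (hfc.comp (continuous_sphereMap (rotEquiv hab t))).aestronglyMeasurable)
    ((hfc.comp (continuous_sphereMap (rotEquiv hab 0))).integrable_of_hasCompactSupport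
      (HasCompactSupport.of_compactSpace _))
    (hGc.comp (continuous_sphereMap (rotEquiv hab 0))).aestronglyMeasurable
    (Eventually.of_forall fun w t _ => hC _ ⟨_, rfl⟩)
    (integrable_const _)
    (Eventually.of_forall fun w t _ => by
      have h1 := (hasDerivAt_rotMap hab t (w : E3)).const_smul r
      exact (hd _ (hmem (sphereMap (rotEquiv hab t) w))).comp_hasDerivAt t h1)
  -- By rotation invariance the integral does not depend on `t`, so its derivative `∫ G` at `t = 0`
  -- vanishes.
  have hconst : (fun t : ℝ => ∫ w, f (r • (sphereMap (rotEquiv hab t) w : E3)) ∂sigma)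
      = fun _ => ∫ w : S2, f (r • (w : E3)) ∂sigma := by
    funext t
    exact integral_sphereMap (rotEquiv hab t) (fun w => f (r • (w : E3)))
  have h0' := key.2
  rw [hconst, integral_sphereMap (rotEquiv hab 0) G] at h0'
  have hz : ∫ w, G w ∂sigma = 0 := h0'.unique (hasDerivAt_const _ _)
  have hGe : ∀ w : S2, G w = r * (omega (r • (w : E3)) a * pd b f (r • (w : E3))
      - omega (r • (w : E3)) b * pd a f (r • (w : E3))) := by
    intro w
    simp only [hG, rotGen, omega, pd, map_smul, map_sub, smul_eq_mul, norm_smul_sphere h0.le,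
      PiLp.smul_apply]
    field_simp
  simp only [hGe] at hz
  rw [integral_const_mul] at hz
  exact (mul_eq_zero.1 hz).resolve_left h0.ne'

/-! ## Cartesian calculus on the exterior region -/

theorem pd_congr {f h : E3 → ℝ} {x : E3} (i : Fin 3) (H : f =ᶠ[𝓝 x] h) : pd i f x = pd i h x := by
  rw [pd, pd, H.fderiv_eq]

theorem pd_mul {f h : E3 → ℝ} {x : E3} (i : Fin 3) (hf : DifferentiableAt ℝ f x)
    (hh : DifferentiableAt ℝ h x) :
    pd i (fun y => f y * h y) x = f x * pd i h x + pd i f x * h x := by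
  simp only [pd, fderiv_fun_mul hf hh, add_apply,
    smul_apply, smul_eq_mul]
  ring

theorem pd_sum {f : Fin 3 → E3 → ℝ} {x : E3} (i : Fin 3) (hf : ∀ j, DifferentiableAt ℝ (f j) x) :
    pd i (fun y => ∑ j, f j y) x = ∑ j, pd i (f j) x := by
  simp only [pd, fderiv_fun_sum fun j _ => hf j, sum_apply]

theorem continuousOn_pd {f : E3 → ℝ} {r₀ : ℝ} (hf : ContDiffOn ℝ 1 f (exterior r₀)) (i : Fin 3) :
    ContinuousOn (pd i f) (exterior r₀) :=
  (hf.continuousOn_fderiv_of_isOpen (isOpen_exterior r₀) le_rfl).clm_apply continuousOn_const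

theorem differentiableAt_of_contDiffOn {f : E3 → ℝ} {r₀ : ℝ} (hf : ContDiffOn ℝ 1 f (exterior r₀))
    {x : E3} (hx : x ∈ exterior r₀) : DifferentiableAt ℝ f x :=
  (hf.differentiableOn one_ne_zero).differentiableAt ((isOpen_exterior r₀).mem_nhds hx)

theorem sum_kron_mul (i : Fin 3) (f : Fin 3 → ℝ) : ∑ j, kron i j * f j = f i := by
  simp [kron]

theorem kron_comm (i j : Fin 3) : kron i j = kron j i := by
  simp only [kron, eq_comm]

theorem sum_omega_sq {x : E3} (hx : x ≠ 0) : ∑ i, omega x i * omega x i = 1 := by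
  have h : ‖x‖ ^ 2 = ∑ i, x i * x i := by
    rw [EuclideanSpace.norm_sq_eq]
    exact Finset.sum_congr rfl fun i _ => by rw [Real.norm_eq_abs, sq_abs, sq]
  have h' : ‖x‖ ≠ 0 := norm_ne_zero_iff.2 hx
  simp only [omega, Fin.sum_univ_three] at h ⊢
  field_simp
  linarith

theorem abs_omega_le_one (x : E3) (i : Fin 3) : |omega x i| ≤ 1 := by
  rw [omega, abs_div, abs_norm]
  exact div_le_one_of_le₀ (by simpa using PiLp.norm_apply_le x i) (norm_nonneg _)

theorem roundMetric_comm (x : E3) (i j : Fin 3) : roundMetric x i j = roundMetric x j i := by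
  simp only [roundMetric, kron_comm i j, mul_comm]

theorem abs_roundMetric_le (x : E3) (i j : Fin 3) : |roundMetric x i j| ≤ 2 := by
  have h1 : |kron i j| ≤ 1 := by unfold kron; split_ifs <;> simp
  have h2 : |omega x i * omega x j| ≤ 1 := by
    rw [abs_mul]
    exact mul_le_one₀ (abs_omega_le_one x i) (abs_nonneg _) (abs_omega_le_one x j)
  exact (abs_sub _ _).trans (by linarith)

theorem sum_roundMetric_mul_omega {x : E3} (hx : x ≠ 0) (i : Fin 3) :
    ∑ j, roundMetric x i j * omega x j = 0 := by
  have h := sum_omega_sq hx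
  simp only [roundMetric, sub_mul, Finset.sum_sub_distrib, sum_kron_mul, mul_assoc,
    ← Finset.mul_sum, h]
  ring

theorem sum_roundMetric_mul_roundMetric {x : E3} (hx : x ≠ 0) (i j : Fin 3) :
    ∑ l, roundMetric x i l * roundMetric x j l = roundMetric x i j := by
  have h := sum_roundMetric_mul_omega hx i
  have h2 : ∀ l, roundMetric x i l * roundMetric x j l
      = kron j l * roundMetric x i l - omega x j * (roundMetric x i l * omega x l) := fun l => by
    rw [roundMetric, roundMetric]; ring
  rw [Finset.sum_congr rfl fun l _ => h2 l, Finset.sum_sub_distrib, ← Finset.mul_sum, h,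
    sum_kron_mul, mul_zero, sub_zero]

theorem sum_roundMetric_self {x : E3} (hx : x ≠ 0) : ∑ i, roundMetric x i i = 2 := by
  have h := sum_omega_sq hx
  simp only [roundMetric, Finset.sum_sub_distrib, h]
  simp [kron]
  norm_num

theorem hasFDerivAt_norm {x : E3} (hx : x ≠ 0) :
    HasFDerivAt (fun y : E3 => ‖y‖) (‖x‖⁻¹ • innerSL ℝ x) x := by
  have h := (hasFDerivAt_id x).norm_sq.sqrt (by simpa using hx)
  simp only [id, Real.sqrt_sq (norm_nonneg _)] at h
  refine h.congr_fderiv ?_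
  ext v
  have h' : ‖x‖ ≠ 0 := norm_ne_zero_iff.2 hx
  simp
  field_simp

theorem pd_omega {x : E3} (hx : x ≠ 0) (i j : Fin 3) :
    pd i (fun y => omega y j) x = roundMetric x i j / ‖x‖ := by
  have h' : ‖x‖ ≠ 0 := norm_ne_zero_iff.2 hx
  have h1 : HasFDerivAt (fun y : E3 => y j) (EuclideanSpace.proj j : E3 →L[ℝ] ℝ) x :=
    (EuclideanSpace.proj j : E3 →L[ℝ] ℝ).hasFDerivAt
  have h2 := h1.mul ((hasDerivAt_inv h').comp_hasFDerivAt x (hasFDerivAt_norm hx))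
  have h3 : pd i (fun y => omega y j) x = _ :=
    congrArg (fun L : E3 →L[ℝ] ℝ => L (EuclideanSpace.single i 1)) h2.fderiv
  rw [h3]
  have h4 : inner ℝ x (EuclideanSpace.single i (1 : ℝ)) = x i := by
    simp [EuclideanSpace.inner_single_right]
  rcases eq_or_ne i j with rfl | hij
  · simp [h4, roundMetric, omega, kron]
    field_simp
    ring
  · simp [h4, roundMetric, omega, kron, hij, hij.symm]
    field_simp

section Regularity

variable {r₀ : ℝ} {n : WithTop ℕ∞}

theorem ne_zero_of_mem_exterior (h0 : 0 < r₀) {x : E3} (hx : x ∈ exterior r₀) : x ≠ 0 :=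
  norm_pos_iff.1 (h0.trans hx)

theorem contDiffOn_omega (h0 : 0 < r₀) (i : Fin 3) :
    ContDiffOn ℝ n (fun x => omega x i) (exterior r₀) := by
  have h1 : ContDiffOn ℝ n (fun x : E3 => x i) (exterior r₀) :=
    (EuclideanSpace.proj i : E3 →L[ℝ] ℝ).contDiff.contDiffOn
  exact h1.div (contDiffOn_id.norm ℝ fun x hx => ne_zero_of_mem_exterior h0 hx)
    fun x hx => (h0.trans hx).ne'

theorem contDiffOn_det {M : E3 → Matrix (Fin 3) (Fin 3) ℝ} {s : Set E3}
    (hM : ∀ i j, ContDiffOn ℝ n (fun x => M x i j) s) :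
    ContDiffOn ℝ n (fun x => (M x).det) s := by
  simp only [Matrix.det_apply]
  exact ContDiffOn.sum fun σ _ => (contDiffOn_prod fun i _ => hM _ _).const_smul _

theorem contDiffOn_matrix_inv {M : E3 → Matrix (Fin 3) (Fin 3) ℝ} {s : Set E3}
    (hM : ∀ i j, ContDiffOn ℝ n (fun x => M x i j) s) (hd : ∀ x ∈ s, (M x).det ≠ 0)
    (i j : Fin 3) : ContDiffOn ℝ n (fun x => (M x)⁻¹ i j) s := by
  simp only [Matrix.inv_def, Ring.inverse_eq_inv', Matrix.smul_apply, Matrix.adjugate_apply]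
  refine ((contDiffOn_det hM).inv hd).smul (contDiffOn_det fun a b => ?_)
  simp only [Matrix.updateRow_apply]
  split_ifs
  exacts [contDiffOn_const, hM _ _]

end Regularity

/-! ## Metrics with radial normal -/

/-- A `C²` metric on the exterior region whose spheres `S_r` are orthogonal to `∂_r`. -/
structure IsRadialMetric (r₀ : ℝ) (g : E3 → Matrix (Fin 3) (Fin 3) ℝ) : Prop where
  pos : 0 < r₀
  contDiff : ∀ i j, ContDiffOn ℝ 2 (fun x => g x i j) (exterior r₀)
  posDef : ∀ x ∈ exterior r₀, (g x).PosDef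
  radial : ∀ x ∈ exterior r₀, ∀ i, ∑ j, g x i j * omega x j = lapse g x ^ 2 * omega x i

namespace IsRadialMetric

variable {r₀ : ℝ} {g : E3 → Matrix (Fin 3) (Fin 3) ℝ} (H : IsRadialMetric r₀ g)
include H

theorem symm {x : E3} (hx : x ∈ exterior r₀) (i j : Fin 3) : g x i j = g x j i := by
  simpa using (H.posDef x hx).isHermitian.apply j i

theorem inv_symm {x : E3} (hx : x ∈ exterior r₀) (i j : Fin 3) : (g x)⁻¹ i j = (g x)⁻¹ j i := by
  simpa using (H.posDef x hx).inv.isHermitian.apply j i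

theorem ne_zero {x : E3} (hx : x ∈ exterior r₀) : x ≠ 0 := ne_zero_of_mem_exterior H.pos hx

theorem inv_radial_pos {x : E3} (hx : x ∈ exterior r₀) :
    0 < ∑ i, ∑ j, (g x)⁻¹ i j * omega x i * omega x j := by
  have hne : omega x ≠ 0 := fun h => by
    have := sum_omega_sq (H.ne_zero hx)
    simp [h] at this
  have := (H.posDef x hx).inv.dotProduct_mulVec_pos hne
  simp only [dotProduct, Matrix.mulVec, Pi.star_apply, star_trivial, Finset.mul_sum] at this
  refine this.trans_eq (Finset.sum_congr rfl fun i _ => Finset.sum_congr rfl fun j _ => ?_)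
  ring

theorem lapse_pos {x : E3} (hx : x ∈ exterior r₀) : 0 < lapse g x :=
  inv_pos.2 (Real.sqrt_pos.2 (H.inv_radial_pos hx))

/-- Obtained by applying `g⁻¹` to `g ω = â² ω`. It allows contractions of `g⁻¹` with the normal to
be evaluated without inverting a matrix. -/
theorem inv_radial {x : E3} (hx : x ∈ exterior r₀) (i : Fin 3) :
    ∑ j, (g x)⁻¹ i j * omega x j = (lapse g x)⁻¹ ^ 2 * omega x i := by
  have h1 : (g x).mulVec (omega x) = lapse g x ^ 2 • omega x := funext fun i => H.radial x hx i
  have h2 : (g x)⁻¹.mulVec ((g x).mulVec (omega x)) = omega x := by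
    rw [Matrix.mulVec_mulVec, Matrix.nonsing_inv_mul _ (H.posDef x hx).det_pos.ne'.isUnit,
      Matrix.one_mulVec]
  rw [h1, Matrix.mulVec_smul] at h2
  have h3 := congrFun h2 i
  simp only [Pi.smul_apply, smul_eq_mul] at h3
  have h4 := (H.lapse_pos hx).ne'
  change (g x)⁻¹.mulVec (omega x) i = _
  rw [← h3]
  field_simp

theorem normalUp_eq {x : E3} (hx : x ∈ exterior r₀) (i : Fin 3) :
    normalUp g x i = (lapse g x)⁻¹ * omega x i := by
  have h4 := (H.lapse_pos hx).ne'
  rw [normalUp, H.inv_radial hx]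
  field_simp

/-- The factors `â⁻¹` in `Nⁱ` and `â` in `Nⱼ` cancel, so the horizontal projection no longer depends
on `g`. -/
theorem hproj_eq {x : E3} (hx : x ∈ exterior r₀) (i j : Fin 3) :
    hproj g x i j = roundMetric x i j := by
  have h4 := (H.lapse_pos hx).ne'
  rw [hproj, H.normalUp_eq hx, normalDown, roundMetric]
  field_simp

theorem hinv_eq {x : E3} (hx : x ∈ exterior r₀) (i j : Fin 3) :
    hinv g x i j = (g x)⁻¹ i j - (lapse g x)⁻¹ ^ 2 * (omega x i * omega x j) := by
  rw [hinv, H.normalUp_eq hx, H.normalUp_eq hx]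
  ring

theorem hmetric_symm {x : E3} (hx : x ∈ exterior r₀) (i j : Fin 3) :
    hmetric g x i j = hmetric g x j i := by
  rw [hmetric, hmetric, H.symm hx i j, mul_comm (normalDown g x i)]

theorem hmetric_radial {x : E3} (hx : x ∈ exterior r₀) (i : Fin 3) :
    ∑ j, hmetric g x i j * omega x j = 0 := by
  have h := sum_omega_sq (H.ne_zero hx)
  have h2 := H.radial x hx i
  simp only [hmetric, normalDown, Fin.sum_univ_three] at *
  linear_combination h2 - lapse g x ^ 2 * omega x i * h

theorem hinv_radial {x : E3} (hx : x ∈ exterior r₀) (i : Fin 3) :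
    ∑ j, hinv g x i j * omega x j = 0 := by
  have h := sum_omega_sq (H.ne_zero hx)
  have h2 := H.inv_radial hx i
  simp only [H.hinv_eq hx, Fin.sum_univ_three] at *
  linear_combination h2 - (lapse g x)⁻¹ ^ 2 * omega x i * h

theorem hinv_mul_hmetric {x : E3} (hx : x ∈ exterior r₀) (i l : Fin 3) :
    ∑ j, hinv g x i j * hmetric g x j l = roundMetric x i l := by
  have h1 : ∑ j, (g x)⁻¹ i j * g x j l = kron i l := by
    have := congrFun (congrFun (Matrix.nonsing_inv_mul _ (H.posDef x hx).det_pos.ne'.isUnit) i) l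
    rw [Matrix.mul_apply] at this
    rw [this, kron, Matrix.one_apply]
  have h2 := H.hinv_radial hx i
  have h3 := H.radial x hx l
  have h4 := (H.lapse_pos hx).ne'
  have h5 : (lapse g x)⁻¹ ^ 2 * lapse g x ^ 2 = 1 := by field_simp
  simp only [H.symm hx l] at h3
  calc ∑ j, hinv g x i j * hmetric g x j l
      = ∑ j, (g x)⁻¹ i j * g x j l
        - (lapse g x)⁻¹ ^ 2 * omega x i * (∑ j, g x j l * omega x j)
        - (lapse g x) ^ 2 * omega x l * ∑ j, hinv g x i j * omega x j := by
        simp only [H.hinv_eq hx, hmetric, normalDown, Fin.sum_univ_three]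
        ring
    _ = _ := by
        rw [h1, h2, h3, roundMetric]
        linear_combination (-omega x i * omega x l) * h5

/-- The resolvent identity `γ⁻¹ - γ₀⁻¹ = -γ⁻¹ (γ - γ₀) γ₀⁻¹` on the tangent plane, where `γ₀⁻¹` acts
as the identity. It yields first the boundedness and then the decay of `γ⁻¹ - γ₀⁻¹`. -/
theorem hinv_sub_roundMetric {x : E3} (hx : x ∈ exterior r₀) (i l : Fin 3) :
    hinv g x i l - roundMetric x i l
      = -∑ j, hinv g x i j * (hmetric g x j l - roundMetric x j l) := by
  have h1 := H.hinv_mul_hmetric hx i l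
  have h2 := H.hinv_radial hx i
  have h3 : ∑ j, hinv g x i j * roundMetric x j l = hinv g x i l := by
    have h : ∀ j, hinv g x i j * roundMetric x j l
        = kron l j * hinv g x i j - omega x l * (hinv g x i j * omega x j) := fun j => by
      rw [roundMetric, kron_comm j l]; ring
    rw [Finset.sum_congr rfl fun j _ => h j, Finset.sum_sub_distrib, ← Finset.mul_sum, h2,
      sum_kron_mul, mul_zero, sub_zero]
  simp only [mul_sub, Finset.sum_sub_distrib, h1, h3]
  ring

theorem sum_hinv_mul_hmetric {x : E3} (hx : x ∈ exterior r₀) :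
    ∑ i, ∑ j, hinv g x i j * hmetric g x i j = 2 := by
  simp only [← sum_roundMetric_self (H.ne_zero hx)]
  refine Finset.sum_congr rfl fun i _ => ?_
  rw [← H.hinv_mul_hmetric hx i i]
  exact Finset.sum_congr rfl fun j _ => by rw [H.hmetric_symm hx]

/-! ### Horizontal restrictions -/

theorem hrestrict_radial (T : E3 → Matrix (Fin 3) (Fin 3) ℝ) {x : E3} (hx : x ∈ exterior r₀)
    (i : Fin 3) : ∑ j, hrestrict g T x i j * omega x j = 0 := by
  simp only [hrestrict, H.hproj_eq hx]
  have h : ∀ j, (∑ a, ∑ b, roundMetric x a i * roundMetric x b j * T x a b) * omega x j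
      = ∑ a, ∑ b, roundMetric x a i * T x a b * (roundMetric x b j * omega x j) := fun j => by
    simp only [Finset.sum_mul]
    exact Finset.sum_congr rfl fun a _ => Finset.sum_congr rfl fun b _ => by ring
  rw [Finset.sum_congr rfl fun j _ => h j, Finset.sum_comm]
  refine Finset.sum_eq_zero fun a _ => ?_
  rw [Finset.sum_comm]
  refine Finset.sum_eq_zero fun b _ => ?_
  rw [← Finset.mul_sum, sum_roundMetric_mul_omega (H.ne_zero hx), mul_zero]

theorem sum_hrestrict (T : E3 → Matrix (Fin 3) (Fin 3) ℝ) {x : E3} (hx : x ∈ exterior r₀) :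
    ∑ i, hrestrict g T x i i = ∑ a, ∑ b, roundMetric x a b * T x a b := by
  simp only [hrestrict, H.hproj_eq hx]
  rw [Finset.sum_comm]
  refine Finset.sum_congr rfl fun a _ => ?_
  rw [Finset.sum_comm]
  refine Finset.sum_congr rfl fun b _ => ?_
  rw [← Finset.sum_mul, sum_roundMetric_mul_roundMetric (H.ne_zero hx)]

/-- `θ̂` is horizontal and has zero trace with respect to `γ`, so its Euclidean trace sees only the
difference of the two inverse metrics. It is therefore a product of two decaying factors. -/
theorem sum_thetaHat {x : E3} (hx : x ∈ exterior r₀) :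
    ∑ i, thetaHat g x i i
      = -∑ i, ∑ j, (hinv g x i j - roundMetric x i j) * thetaHat g x i j := by
  have h1 : ∑ i, ∑ j, hinv g x i j * thetaHat g x i j = 0 := by
    have h2 := H.sum_hinv_mul_hmetric hx
    have h3 : trTheta g x = ∑ i, ∑ j, hinv g x i j * theta g x i j := rfl
    calc ∑ i, ∑ j, hinv g x i j * thetaHat g x i j
        = ∑ i, ∑ j, hinv g x i j * theta g x i j
          - (1 / 2) * trTheta g x * ∑ i, ∑ j, hinv g x i j * hmetric g x i j := by
          simp only [thetaHat, mul_sub, Finset.sum_sub_distrib, Finset.mul_sum]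
          congr 1
          exact Finset.sum_congr rfl fun a _ => Finset.sum_congr rfl fun b _ => by ring
      _ = 0 := by rw [h2, ← h3]; ring
  have h2 : ∀ i, ∑ j, thetaHat g x i j * omega x j = 0 := fun i => by
    have := H.hmetric_radial hx i
    simp only [thetaHat, sub_mul, Finset.sum_sub_distrib, mul_assoc, ← Finset.mul_sum, this]
    rw [show ∑ j, theta g x i j * omega x j = 0 from H.hrestrict_radial _ hx i]
    ring
  have h3 : ∀ i, ∑ j, roundMetric x i j * thetaHat g x i j = thetaHat g x i i := fun i => by
    have : ∀ j, roundMetric x i j * thetaHat g x i j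
        = kron i j * thetaHat g x i j - omega x i * (thetaHat g x i j * omega x j) := fun j => by
      rw [roundMetric]; ring
    rw [Finset.sum_congr rfl fun j _ => this j, Finset.sum_sub_distrib, ← Finset.mul_sum, h2,
      sum_kron_mul, mul_zero, sub_zero]
  simp only [sub_mul, Finset.sum_sub_distrib, h1, h3]
  ring

/-! ### Regularity -/

theorem contDiffOn_inv (i j : Fin 3) : ContDiffOn ℝ 2 (fun x => (g x)⁻¹ i j) (exterior r₀) :=
  contDiffOn_matrix_inv H.contDiff (fun x hx => (H.posDef x hx).det_pos.ne') i j

theorem contDiffOn_lapse : ContDiffOn ℝ 2 (lapse g) (exterior r₀) := by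
  have h : ContDiffOn ℝ 2 (fun x => ∑ i, ∑ j, (g x)⁻¹ i j * omega x i * omega x j)
      (exterior r₀) :=
    ContDiffOn.sum fun i _ => ContDiffOn.sum fun j _ =>
      ((H.contDiffOn_inv i j).mul (contDiffOn_omega H.pos i)).mul (contDiffOn_omega H.pos j)
  exact (h.sqrt fun x hx => (H.inv_radial_pos hx).ne').inv
    fun x hx => (Real.sqrt_pos.2 (H.inv_radial_pos hx)).ne'

theorem contDiffOn_normalUp (i : Fin 3) :
    ContDiffOn ℝ 2 (fun x => normalUp g x i) (exterior r₀) :=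
  H.contDiffOn_lapse.mul (ContDiffOn.sum fun j _ =>
    (H.contDiffOn_inv i j).mul (contDiffOn_omega H.pos j))

theorem contDiffOn_normalDown (i : Fin 3) :
    ContDiffOn ℝ 2 (fun x => normalDown g x i) (exterior r₀) :=
  H.contDiffOn_lapse.mul (contDiffOn_omega H.pos i)

theorem contDiffOn_hproj (i j : Fin 3) :
    ContDiffOn ℝ 2 (fun x => hproj g x i j) (exterior r₀) :=
  contDiffOn_const.sub ((H.contDiffOn_normalUp i).mul (H.contDiffOn_normalDown j))

theorem contDiffOn_hinv (i j : Fin 3) :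
    ContDiffOn ℝ 2 (fun x => hinv g x i j) (exterior r₀) :=
  (H.contDiffOn_inv i j).sub ((H.contDiffOn_normalUp i).mul (H.contDiffOn_normalUp j))

theorem continuousOn_pd_metric (l i j : Fin 3) :
    ContinuousOn (pd l (fun y => g y i j)) (exterior r₀) :=
  continuousOn_pd ((H.contDiff i j).of_le one_le_two) l

theorem continuousOn_christoffel (l i j : Fin 3) :
    ContinuousOn (fun x => christoffel g x l i j) (exterior r₀) :=
  continuousOn_const.mul (continuousOn_finsetSum _ fun a _ =>
    (H.contDiffOn_inv l a).continuousOn.mul (((H.continuousOn_pd_metric i j a).add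
      (H.continuousOn_pd_metric j i a)).sub (H.continuousOn_pd_metric a i j)))

theorem continuousOn_covOne {ψ : E3 → Fin 3 → ℝ}
    (hψ : ∀ i, ContDiffOn ℝ 1 (fun x => ψ x i) (exterior r₀)) (i j : Fin 3) :
    ContinuousOn (fun x => covOne g ψ x i j) (exterior r₀) :=
  (continuousOn_pd (hψ j) i).sub (continuousOn_finsetSum _ fun a _ =>
    (H.continuousOn_christoffel a i j).mul (hψ a).continuousOn)

theorem continuousOn_hrestrict {T : E3 → Matrix (Fin 3) (Fin 3) ℝ}
    (hT : ∀ i j, ContinuousOn (fun x => T x i j) (exterior r₀)) (i j : Fin 3) :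
    ContinuousOn (fun x => hrestrict g T x i j) (exterior r₀) :=
  continuousOn_finsetSum _ fun a _ => continuousOn_finsetSum _ fun b _ =>
    ((H.contDiffOn_hproj a i).continuousOn.mul (H.contDiffOn_hproj b j).continuousOn).mul (hT a b)

theorem continuousOn_htrace {T : E3 → Matrix (Fin 3) (Fin 3) ℝ}
    (hT : ∀ i j, ContinuousOn (fun x => T x i j) (exterior r₀)) :
    ContinuousOn (fun x => ∑ i, ∑ j, hinv g x i j * hrestrict g T x i j) (exterior r₀) :=
  continuousOn_finsetSum _ fun i _ => continuousOn_finsetSum _ fun j _ =>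
    (H.contDiffOn_hinv i j).continuousOn.mul (H.continuousOn_hrestrict hT i j)

theorem continuousOn_trTheta : ContinuousOn (trTheta g) (exterior r₀) :=
  H.continuousOn_htrace fun i j =>
    H.continuousOn_covOne (fun i => (H.contDiffOn_normalDown i).of_le one_le_two) i j

theorem continuousOn_trBigTheta {k : E3 → Matrix (Fin 3) (Fin 3) ℝ}
    (hk : ∀ i j, ContDiffOn ℝ 1 (fun x => k x i j) (exterior r₀)) :
    ContinuousOn (trBigTheta g k) (exterior r₀) :=
  H.continuousOn_htrace fun i j => (hk i j).continuousOn

theorem contDiffOn_bigXi {k : E3 → Matrix (Fin 3) (Fin 3) ℝ}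
    (hk : ∀ i j, ContDiffOn ℝ 1 (fun x => k x i j) (exterior r₀)) (i : Fin 3) :
    ContDiffOn ℝ 1 (fun x => bigXi g k x i) (exterior r₀) :=
  ContDiffOn.sum fun a _ => ContDiffOn.sum fun b _ =>
    (((H.contDiffOn_normalUp a).of_le one_le_two).mul (hk a b)).mul
      ((H.contDiffOn_hproj b i).of_le one_le_two)

theorem continuousOn_hvol (i j : Fin 3) : ContinuousOn (fun x => hvol g x i j) (exterior r₀) :=
  (((contDiffOn_det H.contDiff).sqrt fun x hx => (H.posDef x hx).det_pos.ne').inv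
    fun x hx => (Real.sqrt_pos.2 (H.posDef x hx).det_pos).ne').continuousOn.mul
    (continuousOn_finsetSum _ fun l _ =>
      continuousOn_const.mul (H.contDiffOn_normalDown l).continuousOn)

theorem continuousOn_hcurl {ψ : E3 → Fin 3 → ℝ}
    (hψ : ∀ i, ContDiffOn ℝ 1 (fun x => ψ x i) (exterior r₀)) :
    ContinuousOn (hcurl g ψ) (exterior r₀) :=
  continuousOn_finsetSum _ fun i _ => continuousOn_finsetSum _ fun j _ =>
    (H.continuousOn_hvol i j).mul (H.continuousOn_covOne hψ i j)

/-! ### First derivatives of the metric -/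

theorem pd_symm {x : E3} (hx : x ∈ exterior r₀) (l i j : Fin 3) :
    pd l (fun y => g y i j) x = pd l (fun y => g y j i) x :=
  pd_congr l (by
    filter_upwards [(isOpen_exterior r₀).mem_nhds hx] with y hy using H.symm hy i j)

theorem differentiableAt {x : E3} (hx : x ∈ exterior r₀) (i j : Fin 3) :
    DifferentiableAt ℝ (fun y => g y i j) x :=
  differentiableAt_of_contDiffOn ((H.contDiff i j).of_le one_le_two) hx

theorem differentiableAt_lapse {x : E3} (hx : x ∈ exterior r₀) : DifferentiableAt ℝ (lapse g) x :=
  differentiableAt_of_contDiffOn (H.contDiffOn_lapse.of_le one_le_two) hx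

omit H in
theorem differentiableAt_omega (h0 : 0 < r₀) {x : E3} (hx : x ∈ exterior r₀) (i : Fin 3) :
    DifferentiableAt ℝ (fun y => omega y i) x :=
  differentiableAt_of_contDiffOn (contDiffOn_omega h0 i) hx

/-- The derivative of the identity `gⱼₗ ωₗ = â² ωⱼ`. -/
theorem sum_pd_mul_omega {x : E3} (hx : x ∈ exterior r₀) (i j : Fin 3) :
    ∑ l, pd i (fun y => g y j l) x * omega x l
      = 2 * lapse g x * pd i (lapse g) x * omega x j
        + (lapse g x ^ 2 * roundMetric x i j - hmetric g x i j) / ‖x‖ := by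
  have hw := fun l => differentiableAt_omega H.pos hx l
  have hl := H.differentiableAt_lapse hx
  have hpw := pd_omega (H.ne_zero hx)
  have h1 : pd i (fun y => ∑ l, g y j l * omega y l) x
      = ∑ l, (g x j l * (roundMetric x i l / ‖x‖) + pd i (fun y => g y j l) x * omega x l) := by
    rw [pd_sum i fun l => (H.differentiableAt hx j l).fun_mul (hw l)]
    exact Finset.sum_congr rfl fun l _ => by rw [pd_mul i (H.differentiableAt hx j l) (hw l), hpw]
  have h2 : pd i (fun y => ∑ l, g y j l * omega y l) x
      = lapse g x * (lapse g x * (roundMetric x i j / ‖x‖) + pd i (lapse g) x * omega x j)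
        + pd i (lapse g) x * (lapse g x * omega x j) := by
    have : (fun y => ∑ l, g y j l * omega y l)
        =ᶠ[𝓝 x] fun y => lapse g y * (lapse g y * omega y j) := by
      filter_upwards [(isOpen_exterior r₀).mem_nhds hx] with y hy
      rw [H.radial y hy j]; ring
    rw [pd_congr i this, pd_mul i hl (hl.fun_mul (hw j)), pd_mul i hl (hw j), hpw]
  have h3 : ∑ l, g x j l * roundMetric x i l = hmetric g x i j := by
    have : ∀ l, g x j l * roundMetric x i l
        = kron i l * g x j l - omega x i * (g x j l * omega x l) := fun l => by
      rw [roundMetric]; ring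
    rw [Finset.sum_congr rfl fun l _ => this l, Finset.sum_sub_distrib, ← Finset.mul_sum,
      H.radial x hx, sum_kron_mul, hmetric, normalDown, normalDown, H.symm hx i j]
    ring
  rw [h1, Finset.sum_add_distrib] at h2
  simp only [← mul_div_assoc, ← Finset.sum_div, h3] at h2
  linear_combination h2

/-- The radial component of the Christoffel symbols, in `∇N = d(â ω) - Γ`. -/
theorem covOne_normalDown {x : E3} (hx : x ∈ exterior r₀) (a b : Fin 3) :
    covOne g (normalDown g) x a b
      = hmetric g x a b / (‖x‖ * lapse g x)
        + (∑ l, omega x l * pd l (fun y => g y a b) x) / (2 * lapse g x)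
        - pd b (lapse g) x * omega x a := by
  have hA := (H.lapse_pos hx).ne'
  have hr : ‖x‖ ≠ 0 := norm_ne_zero_iff.2 (H.ne_zero hx)
  have h1 : pd a (fun y => normalDown g y b) x
      = lapse g x * (roundMetric x a b / ‖x‖) + pd a (lapse g) x * omega x b := by
    simp only [normalDown]
    rw [pd_mul a (H.differentiableAt_lapse hx) (differentiableAt_omega H.pos hx b),
      pd_omega (H.ne_zero hx)]
  -- The inverse metric inside the Christoffel symbol meets the normal, and `inv_radial` reduces it
  -- to the scalar `â⁻²`.
  have h2 : ∑ c, christoffel g x c a b * normalDown g x c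
      = (1 / 2) * (lapse g x)⁻¹ * (∑ l, pd a (fun y => g y b l) x * omega x l
        + ∑ l, pd b (fun y => g y a l) x * omega x l
        - ∑ l, omega x l * pd l (fun y => g y a b) x) := by
    simp only [christoffel, normalDown]
    have h3 : ∀ c, (1 / 2) * (∑ l, (g x)⁻¹ c l * (pd a (fun y => g y b l) x
          + pd b (fun y => g y a l) x - pd l (fun y => g y a b) x)) * (lapse g x * omega x c)
        = ∑ l, (1 / 2) * lapse g x * (pd a (fun y => g y b l) x
          + pd b (fun y => g y a l) x - pd l (fun y => g y a b) x)
          * ((g x)⁻¹ l c * omega x c) := fun c => by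
      rw [Finset.mul_sum, Finset.sum_mul]
      exact Finset.sum_congr rfl fun l _ => by rw [H.inv_symm hx c l]; ring
    rw [Finset.sum_congr rfl fun c _ => h3 c, Finset.sum_comm]
    simp only [← Finset.mul_sum, H.inv_radial hx]
    rw [← Finset.sum_add_distrib, ← Finset.sum_sub_distrib, Finset.mul_sum]
    refine Finset.sum_congr rfl fun l _ => ?_
    field_simp
  rw [covOne, h1, h2, H.sum_pd_mul_omega hx, H.sum_pd_mul_omega hx, H.hmetric_symm hx b a,
    roundMetric_comm x b a]
  field_simp
  ring

/-- The Euclidean trace of `θ` in terms of the radial derivative of the metric. -/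
theorem sum_theta {x : E3} (hx : x ∈ exterior r₀) :
    2 * lapse g x * ∑ i, theta g x i i
      = 2 * (∑ i, hmetric g x i i) / ‖x‖ + ∑ l, ∑ i, omega x l * pd l (fun y => g y i i) x
        - 2 * lapse g x * ∑ l, pd l (lapse g) x * omega x l := by
  have hA := (H.lapse_pos hx).ne'
  have hr : ‖x‖ ≠ 0 := norm_ne_zero_iff.2 (H.ne_zero hx)
  set q : Fin 3 → Fin 3 → ℝ := fun a b => covOne g (normalDown g) x a b with hq
  have e1 : ∑ i, theta g x i i = ∑ a, ∑ b, roundMetric x a b * q a b := H.sum_hrestrict _ hx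
  have e2 : ∀ a, ∑ b, roundMetric x a b * q a b = q a a - omega x a * ∑ b, q a b * omega x b := by
    intro a
    have : ∀ b, roundMetric x a b * q a b = kron a b * q a b - omega x a * (q a b * omega x b) :=
      fun b => by rw [roundMetric]; ring
    rw [Finset.sum_congr rfl fun b _ => this b, Finset.sum_sub_distrib, ← Finset.mul_sum,
      sum_kron_mul]
  have hw := sum_omega_sq (H.ne_zero hx)
  have e3 : ∀ a, ∑ b, q a b * omega x b
      = (∑ l, omega x l * ∑ b, pd l (fun y => g y a b) x * omega x b) / (2 * lapse g x)
        - (∑ b, pd b (lapse g) x * omega x b) * omega x a := by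
    intro a
    have h := H.hmetric_radial hx a
    simp only [hq, H.covOne_normalDown hx, Fin.sum_univ_three] at h ⊢
    linear_combination h / (‖x‖ * lapse g x)
  -- In the direction `ω` the tangential terms of `sum_pd_mul_omega` vanish, because both `γ` and
  -- `γ⁽⁰⁾` annihilate `ω`.
  have e4 : ∀ a, ∑ l, omega x l * ∑ b, pd l (fun y => g y a b) x * omega x b
      = 2 * lapse g x * (∑ l, pd l (lapse g) x * omega x l) * omega x a := by
    intro a
    have h := H.hmetric_radial hx a
    have h' := sum_roundMetric_mul_omega (H.ne_zero hx) a
    simp only [H.sum_pd_mul_omega hx, H.hmetric_symm hx _ a, roundMetric_comm x _ a,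
      Fin.sum_univ_three] at h h' ⊢
    linear_combination (lapse g x ^ 2 / ‖x‖) * h' - (1 / ‖x‖) * h
  -- The removed term is a multiple of `Nᵇ ∇ₐ N_b`, which is zero because `N` has unit length. Here
  -- this appears as the cancellation of `e3` and `e4`.
  have e5 : ∀ a, ∑ b, roundMetric x a b * q a b = q a a := by
    intro a
    rw [e2, e3, e4]
    field_simp
    ring
  rw [e1]
  simp only [e5]
  simp only [hq, H.covOne_normalDown hx]
  rw [Finset.sum_comm (f := fun l i => omega x l * pd l (fun y => g y i i) x)]
  simp only [Fin.sum_univ_three]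
  field_simp
  ring

/-- The ADM energy integrand. -/
theorem adm_integrand {x : E3} (hx : x ∈ exterior r₀) :
    ∑ i, ∑ j, (pd i (fun y => g y i j) x - pd j (fun y => g y i i) x) * omega x j
      = 2 * lapse g x ^ 2 / ‖x‖ + (∑ i, hmetric g x i i) / ‖x‖
        - 2 * lapse g x * ∑ i, theta g x i i := by
  have h1 := H.sum_theta hx
  have h2 := H.sum_pd_mul_omega hx
  have h3 : ∀ i, ∑ j, (pd i (fun y => g y i j) x - pd j (fun y => g y i i) x) * omega x j
      = ∑ j, pd i (fun y => g y i j) x * omega x j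
        - ∑ j, omega x j * pd j (fun y => g y i i) x := fun i => by
    rw [← Finset.sum_sub_distrib]
    exact Finset.sum_congr rfl fun j _ => by ring
  have h4 := sum_roundMetric_self (H.ne_zero hx)
  have hr : ‖x‖ ≠ 0 := norm_ne_zero_iff.2 (H.ne_zero hx)
  -- Writing `2â ∑ θᵢᵢ` out by `sum_theta` makes the radial derivatives of `g` and of `â` match
  -- those on the left, so both cancel.
  rw [h1]
  simp only [h3, h2]
  rw [Finset.sum_comm (f := fun l i => omega x l * pd l (fun y => g y i i) x)]
  simp only [Fin.sum_univ_three] at h4 ⊢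
  field_simp
  linear_combination (lapse g x ^ 2) * h4

/-- The Euclidean trace of `θ` in terms of `tr θ` and `θ̂`. -/
theorem sum_theta_eq {x : E3} (hx : x ∈ exterior r₀) :
    ∑ i, theta g x i i = (1 / 2) * trTheta g x * ∑ i, hmetric g x i i
      - ∑ i, ∑ j, (hinv g x i j - roundMetric x i j) * thetaHat g x i j := by
  have h := H.sum_thetaHat hx
  rw [sub_eq_add_neg, ← h, Finset.mul_sum, ← Finset.sum_add_distrib]
  exact Finset.sum_congr rfl fun i _ => by rw [thetaHat]; ring

/-! ### Components of `k` -/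

section SecondFundamentalForm

variable {k : E3 → Matrix (Fin 3) (Fin 3) ℝ}

theorem bigPi_eq {x : E3} (hx : x ∈ exterior r₀) :
    lapse g x ^ 2 * bigPi g k x = ∑ a, ∑ b, omega x a * omega x b * k x a b := by
  have hA := (H.lapse_pos hx).ne'
  simp only [bigPi, H.normalUp_eq hx, Finset.mul_sum]
  refine Finset.sum_congr rfl fun a _ => Finset.sum_congr rfl fun b _ => ?_
  field_simp

/-- Symmetry of `k` is what lets `Ξ`, defined with `N` in the first slot, describe a contraction in
the second slot. -/
theorem sum_mul_omega {x : E3} (hx : x ∈ exterior r₀) (hk : (k x).IsSymm) (i : Fin 3) :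
    ∑ j, k x i j * omega x j
      = lapse g x * bigXi g k x i + lapse g x ^ 2 * bigPi g k x * omega x i := by
  have hA := (H.lapse_pos hx).ne'
  have h1 : lapse g x * bigXi g k x i
      = ∑ a, omega x a * ∑ b, roundMetric x b i * k x a b := by
    simp only [bigXi, H.normalUp_eq hx, H.hproj_eq hx, Finset.mul_sum]
    refine Finset.sum_congr rfl fun a _ => Finset.sum_congr rfl fun b _ => ?_
    field_simp
  have h2 : ∀ a, ∑ b, roundMetric x b i * k x a b
      = k x i a - omega x i * ∑ b, omega x b * k x a b := fun a => by
    have : ∀ b, roundMetric x b i * k x a b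
        = kron i b * k x a b - omega x i * (omega x b * k x a b) := fun b => by
      rw [roundMetric, kron_comm b i]; ring
    rw [Finset.sum_congr rfl fun b _ => this b, Finset.sum_sub_distrib, ← Finset.mul_sum,
      sum_kron_mul, hk.apply]
  rw [h1, H.bigPi_eq hx]
  simp only [h2, Fin.sum_univ_three]
  ring

theorem sum_diag {x : E3} (hx : x ∈ exterior r₀) :
    ∑ a, k x a a = lapse g x ^ 2 * bigPi g k x + ∑ i, bigTheta g k x i i := by
  have h1 : ∑ i, bigTheta g k x i i = ∑ a, ∑ b, roundMetric x a b * k x a b :=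
    H.sum_hrestrict k hx
  have h2 : ∀ a, ∑ b, roundMetric x a b * k x a b
      = k x a a - ∑ b, omega x a * omega x b * k x a b := fun a => by
    have : ∀ b, roundMetric x a b * k x a b
        = kron a b * k x a b - omega x a * omega x b * k x a b := fun b => by
      rw [roundMetric]; ring
    rw [Finset.sum_congr rfl fun b _ => this b, Finset.sum_sub_distrib, sum_kron_mul]
  rw [h1, H.bigPi_eq hx]
  simp only [h2, Finset.sum_sub_distrib]
  ring

/-- The ADM momentum integrand. -/
theorem momentum_integrand {x : E3} (hx : x ∈ exterior r₀) (hk : (k x).IsSymm) (i : Fin 3) :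
    ∑ j, (k x i j - (∑ a, k x a a) * g x i j) * omega x j
      = lapse g x * bigXi g k x i + lapse g x ^ 2 * (bigPi g k x * (1 - lapse g x ^ 2)
        - ∑ a, bigTheta g k x a a) * omega x i := by
  have h1 := H.sum_mul_omega hx hk i
  have h2 := H.radial x hx i
  simp only [sub_mul, Finset.sum_sub_distrib, h1, mul_assoc, ← Finset.mul_sum, h2]
  rw [H.sum_diag (k := k) hx]
  ring

/-- The ADM angular momentum integrand. -/
theorem angular_integrand {x : E3} (hx : x ∈ exterior r₀) (hk : (k x).IsSymm) (i : Fin 3) :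
    ∑ j, ∑ l, ∑ n, eps i l n * x l * (k x n j - (∑ a, k x a a) * g x n j) * omega x j
      = ‖x‖ * lapse g x * ∑ l, ∑ n, eps i l n * omega x l * bigXi g k x n := by
  have hr : ‖x‖ ≠ 0 := norm_ne_zero_iff.2 (H.ne_zero hx)
  have hx' : ∀ l, x l = ‖x‖ * omega x l := fun l => by rw [omega]; field_simp
  have h1 := fun n => H.momentum_integrand hx hk n
  have h2 : ∑ j, ∑ l, ∑ n, eps i l n * x l * (k x n j - (∑ a, k x a a) * g x n j) * omega x j
      = ∑ l, ∑ n, eps i l n * (‖x‖ * omega x l)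
        * ∑ j, (k x n j - (∑ a, k x a a) * g x n j) * omega x j := by
    rw [Finset.sum_comm]
    refine Finset.sum_congr rfl fun l _ => ?_
    rw [Finset.sum_comm]
    refine Finset.sum_congr rfl fun n _ => ?_
    rw [Finset.mul_sum, ← hx' l]
    exact Finset.sum_congr rfl fun j _ => by ring
  rw [h2]
  simp only [h1]
  -- The radial part of each momentum integrand is a multiple of `ω_n` and drops out since `ε_{iln}
  -- ω_l ω_n = 0`. Only `Ξ` is left.
  fin_cases i <;> simp [Fin.sum_univ_three, eps] <;> ring

end SecondFundamentalForm

/-! ### The horizontal curl -/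

theorem christoffel_symm {x : E3} (hx : x ∈ exterior r₀) (l i j : Fin 3) :
    christoffel g x l i j = christoffel g x l j i := by
  simp only [christoffel]
  congr 1
  refine Finset.sum_congr rfl fun a _ => ?_
  rw [H.pd_symm hx a i j]
  ring

/-- Antisymmetrization removes the torsion-free connection. The metric enters only through the
scalar factor of the volume form. -/
theorem hcurl_eq {x : E3} (hx : x ∈ exterior r₀) (ψ : E3 → Fin 3 → ℝ) :
    hcurl g ψ x = (Real.sqrt (g x).det)⁻¹ * lapse g x
      * ∑ l, ∑ i, ∑ j, eps l i j * omega x l * pd i (fun y => ψ y j) x := by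
  have hs := H.christoffel_symm hx
  simp only [hcurl, hvol, covOne, normalDown]
  set p : Fin 3 → Fin 3 → ℝ := fun i j => pd i (fun y => ψ y j) x
  set c : Fin 3 → Fin 3 → ℝ := fun i j => ∑ a, christoffel g x a i j * ψ x a with hc
  have hcs : ∀ i j, c i j = c j i := fun i j => by simp only [hc, hs _ i j]
  have h10 := hcs 1 0
  have h20 := hcs 2 0
  have h21 := hcs 2 1
  change ∑ i, ∑ j, _ * (p i j - c i j) = _ * ∑ l, ∑ i, ∑ j, eps l i j * omega x l * p i j
  simp only [Fin.sum_univ_three, h10, h20, h21]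
  simp [eps]
  ring

/-- `det g = â² det (1 + γ - γ⁽⁰⁾)`. -/
theorem det_eq {x : E3} (hx : x ∈ exterior r₀) :
    (g x).det = lapse g x ^ 2
      * (1 + Matrix.of fun i j => hmetric g x i j - roundMetric x i j).det := by
  -- Since `1 - γ⁽⁰⁾ = ω ⊗ ω` and `γ ω = 0`, this is the factorization `g = (γ + ω ⊗ ω)(1 + (â² - 1)
  -- ω ⊗ ω)`. The second factor is a rank-one update of the identity, with determinant `â²`.
  have h1 : g x = (1 + Matrix.of fun i j => hmetric g x i j - roundMetric x i j)
      * (1 + Matrix.replicateCol Unit (fun i => (lapse g x ^ 2 - 1) * omega x i)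
        * Matrix.replicateRow Unit (omega x)) := by
    ext i j
    have h2 := H.hmetric_radial hx i
    have h4 : ∀ a b, (1 : Matrix (Fin 3) (Fin 3) ℝ) a b = kron a b := fun a b => by
      rw [kron, Matrix.one_apply]
    have h5 : ∀ a, (1 + Matrix.of fun i j => hmetric g x i j - roundMetric x i j) i a
        = hmetric g x i a + omega x i * omega x a := fun a => by
      rw [Matrix.add_apply, h4, Matrix.of_apply, roundMetric]; ring
    have h6 := sum_omega_sq (H.ne_zero hx)
    have h7 : ∀ a, (1 + Matrix.replicateCol Unit (fun i => (lapse g x ^ 2 - 1) * omega x i)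
        * Matrix.replicateRow Unit (omega x) : Matrix (Fin 3) (Fin 3) ℝ) a j
        = kron j a + (lapse g x ^ 2 - 1) * omega x a * omega x j := fun a => by
      rw [Matrix.add_apply, h4, kron_comm, Matrix.mul_apply]
      simp
    rw [Matrix.mul_apply]
    simp only [h5, h7]
    have h8 := sum_kron_mul j fun a => hmetric g x i a + omega x i * omega x a
    simp only [Fin.sum_univ_three] at h2 h6 h8 ⊢
    have h9 : g x i j = hmetric g x i j + lapse g x ^ 2 * (omega x i * omega x j) := by
      rw [hmetric, normalDown, normalDown]; ring
    linear_combination h9 - h8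
      - (lapse g x ^ 2 - 1) * omega x j * h2 - (lapse g x ^ 2 - 1) * omega x i * omega x j * h6
  conv_lhs => rw [h1]
  rw [Matrix.det_mul, Matrix.det_one_add_replicateCol_mul_replicateRow]
  have h6 := sum_omega_sq (H.ne_zero hx)
  have h9 : omega x ⬝ᵥ (fun i => (lapse g x ^ 2 - 1) * omega x i) = lapse g x ^ 2 - 1 := by
    simp only [dotProduct, Fin.sum_univ_three] at h6 ⊢
    linear_combination (lapse g x ^ 2 - 1) * h6
  rw [h9]
  ring

end IsRadialMetric

/-! ## Decay at infinity -/

/-- `f = O(|x|^{-q})` at infinity. -/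
def Decays (q : ℝ) (f : E3 → ℝ) : Prop := f =O[Bornology.cobounded E3] fun x => ‖x‖ ^ (-q)

theorem eventually_exterior (R : ℝ) : ∀ᶠ x in Bornology.cobounded E3, x ∈ exterior R :=
  tendsto_norm_cobounded_atTop.eventually (eventually_gt_atTop R)

namespace Decays

variable {p q : ℝ} {f h : E3 → ℝ}

theorem congr' (hf : Decays q f) {r₀ : ℝ} (H : ∀ x ∈ exterior r₀, h x = f x) : Decays q h :=
  Asymptotics.IsBigO.congr' hf (by
    filter_upwards [eventually_exterior r₀] with x hx using (H x hx).symm) EventuallyEq.rfl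

theorem add (hf : Decays q f) (hh : Decays q h) : Decays q fun x => f x + h x :=
  Asymptotics.IsBigO.add hf hh

theorem sub (hf : Decays q f) (hh : Decays q h) : Decays q fun x => f x - h x :=
  Asymptotics.IsBigO.sub hf hh

theorem const_mul (c : ℝ) (hf : Decays q f) : Decays q fun x => c * f x :=
  Asymptotics.IsBigO.const_mul_left hf c

theorem sum {ι : Type*} {s : Finset ι} {F : ι → E3 → ℝ} (hF : ∀ i ∈ s, Decays q (F i)) :
    Decays q fun x => ∑ i ∈ s, F i x :=
  Asymptotics.IsBigO.fun_sum hF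

theorem mono (hf : Decays q f) (hpq : p ≤ q) : Decays p f := by
  refine hf.trans (Asymptotics.IsBigO.of_bound 1 ?_)
  filter_upwards [eventually_exterior 1] with x hx
  have hx : 1 < ‖x‖ := hx
  rw [Real.norm_of_nonneg (by positivity), Real.norm_of_nonneg (by positivity), one_mul]
  exact Real.rpow_le_rpow_of_exponent_le hx.le (by linarith)

theorem mul (hf : Decays p f) (hh : Decays q h) : Decays (p + q) fun x => f x * h x := by
  refine (Asymptotics.IsBigO.mul hf hh).congr' EventuallyEq.rfl ?_
  filter_upwards [eventually_exterior 0] with x hx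
  rw [← Real.rpow_add hx]
  congr 1; ring

theorem mul_bounded (hf : Decays q f) (hh : Decays 0 h) : Decays q fun x => f x * h x := by
  simpa using hf.mul hh

theorem bounded_mul (hf : Decays 0 f) (hh : Decays q h) : Decays q fun x => f x * h x := by
  simpa using hf.mul hh

theorem of_bound {r₀ C : ℝ} (hf : ∀ x ∈ exterior r₀, |f x| ≤ C * ‖x‖ ^ (-q)) : Decays q f := by
  refine Asymptotics.IsBigO.of_bound C ?_
  filter_upwards [eventually_exterior r₀] with x hx
  rw [Real.norm_of_nonneg (Real.rpow_nonneg (norm_nonneg x) _)]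
  exact hf x hx

theorem of_bounded {r₀ C : ℝ} (hf : ∀ x ∈ exterior r₀, |f x| ≤ C) : Decays 0 f :=
  of_bound (r₀ := r₀) (C := C) fun x hx => by simpa using hf x hx

theorem const (c : ℝ) : Decays 0 fun _ => c := of_bounded (r₀ := 0) (C := |c|) fun _ _ => le_rfl

theorem norm : Decays (-1) fun x => ‖x‖ :=
  of_bound (r₀ := 0) (C := 1) fun x _ => by simp

theorem inv_norm : Decays 1 fun x => ‖x‖⁻¹ :=
  of_bound (r₀ := 0) (C := 1) fun x _ => by simp [Real.rpow_neg_one]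

theorem omega (i : Fin 3) : Decays 0 fun x => omega x i :=
  of_bounded (r₀ := 0) (C := 1) fun x _ => abs_omega_le_one x i

theorem tendsto_zero (hf : Decays q f) (hq : 0 < q) : Tendsto f (Bornology.cobounded E3) (𝓝 0) :=
  hf.trans_tendsto ((tendsto_rpow_neg_atTop hq).comp tendsto_norm_cobounded_atTop)

theorem eventually_abs_le (hf : Decays q f) (hq : 0 < q) {ε : ℝ} (hε : 0 < ε) :
    ∀ᶠ x in Bornology.cobounded E3, |f x| ≤ ε := by
  have := (hf.tendsto_zero hq).norm.eventually (eventually_le_nhds (by simpa using hε))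
  simpa using this

theorem bounded (hf : Decays q fun x => f x - h x) (hq : 0 ≤ q) (hh : Decays 0 h) :
    Decays 0 f := by
  simpa using (hf.mono hq).add hh

/-- Where `f ≥ 0`, the factorization `f - 1 = (√f - 1)(√f + 1)` with `√f + 1 ≥ 1` gives `|√f - 1| ≤
|f - 1|`. The threshold `1 / 2` only serves to ensure `f ≥ 0`. -/
theorem sqrt_sub_one (hf : Decays q fun x => f x - 1) (hq : 0 < q) :
    Decays q fun x => √(f x) - 1 := by
  refine (Asymptotics.IsBigO.of_bound 1 ?_).trans hf
  filter_upwards [hf.eventually_abs_le hq (ε := 1 / 2) (by norm_num)] with x hx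
  have h1 : 0 ≤ f x := by linarith [(abs_le.1 hx).1]
  have h2 : f x - 1 = (√(f x) - 1) * (√(f x) + 1) := by
    linear_combination -Real.sq_sqrt h1
  rw [one_mul, h2, norm_mul, Real.norm_eq_abs (√(f x) + 1), abs_of_nonneg (by positivity)]
  exact le_mul_of_one_le_right (norm_nonneg _) (by linarith [Real.sqrt_nonneg (f x)])

theorem inv_sqrt_sub_one (hf : Decays q fun x => f x - 1) (hq : 0 < q) :
    Decays q fun x => (√(f x))⁻¹ - 1 := by
  have hs := hf.sqrt_sub_one hq
  -- The constant `2` bounds `1/√f` once `√f ≥ 1/2`.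
  refine (Asymptotics.IsBigO.of_bound 2 ?_).trans hs
  filter_upwards [hs.eventually_abs_le hq (ε := 1 / 2) (by norm_num)] with x hx
  have h1 : 1 / 2 ≤ √(f x) := by linarith [(abs_le.1 hx).1]
  have h0 : 0 < √(f x) := by linarith
  have h2 : (√(f x))⁻¹ - 1 = -((√(f x))⁻¹ * (√(f x) - 1)) := by field_simp; ring
  have h3 : (√(f x))⁻¹ ≤ 2 := by
    rw [inv_le_comm₀ h0 two_pos]; linarith
  rw [h2, norm_neg, norm_mul, Real.norm_of_nonneg (inv_nonneg.2 h0.le)]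
  gcongr

theorem det_one_add_sub_one {M : E3 → Matrix (Fin 3) (Fin 3) ℝ} (hq : 0 ≤ q)
    (hM : ∀ i j, Decays q fun x => M x i j) : Decays q fun x => (1 + M x).det - 1 := by
  have hb : ∀ i j, Decays 0 fun x => M x i j := fun i j => (hM i j).mono hq
  have h1 : ∀ i, Decays 0 fun x => 1 + M x i i := fun i => (const 1).add (hb i i)
  -- Each term of the expanded determinant, apart from the leading `1`, contains an entry of `M`
  -- that carries the decay. The other factors are merely bounded.
  have h := (((hM 0 0).mul_bounded ((h1 1).mul_bounded (h1 2))).add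
    (((hM 1 1).mul_bounded (h1 2)).add (hM 2 2))).add
    ((((hM 0 1).mul_bounded ((hb 1 2).mul_bounded (hb 2 0))).sub
      ((hM 0 1).mul_bounded ((hb 1 0).mul_bounded (h1 2)))).add
      ((((hM 0 2).mul_bounded ((hb 1 0).mul_bounded (hb 2 1))).sub
      ((hM 0 2).mul_bounded ((hb 2 0).mul_bounded (h1 1)))).sub
      ((hM 1 2).mul_bounded ((hb 2 1).mul_bounded (h1 0)))))
  refine h.congr' (r₀ := 0) fun x _ => ?_
  simp [Matrix.det_fin_three]
  ring

end Decays

theorem HorizontalO.decays {r₀ q : ℝ} {s n : ℕ} {U : E3 → (Fin n → Fin 3) → ℝ}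
    (h : HorizontalO r₀ s q U) (I : Fin n → Fin 3) : Decays q fun x => U x I := by
  cases s with
  | zero => obtain ⟨C, hC⟩ := h; exact .of_bound fun x hx => hC x hx I
  | succ s => obtain ⟨⟨C, hC⟩, -⟩ := h; exact .of_bound fun x hx => hC x hx I

/-! ## Asymptotics of gauged exterior data -/

namespace IsGaugedExteriorData

variable {m r₀ δ : ℝ} {c b a : Fin 3 → ℝ} {g k : E3 → Matrix (Fin 3) (Fin 3) ℝ}

theorem isRadialMetric (h0 : 0 < r₀) (D : IsGaugedExteriorData m r₀ δ c b a g k) :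
    IsRadialMetric r₀ g :=
  ⟨h0, D.contDiff_g, D.posDef_g, D.radial_g⟩

variable (D : IsGaugedExteriorData m r₀ δ c b a g k)
include D

theorem decays_lapseCheck : Decays (1 + δ) (lapseCheck m g) := D.bound_lapse.decays ![]

theorem decays_metric (i j : Fin 3) :
    Decays (1 + δ) fun x => hmetric g x i j - roundMetric x i j := D.bound_metric.decays ![i, j]

theorem decays_trThetaCheck : Decays (2 + δ) (trThetaCheck m g) := D.bound_trTheta.decays ![]

theorem decays_thetaHat (i j : Fin 3) : Decays (2 + δ) fun x => thetaHat g x i j :=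
  D.bound_thetaHat.decays ![i, j]

theorem decays_bigTheta (i j : Fin 3) : Decays (2 + δ) fun x => bigTheta g k x i j :=
  D.bound_bigTheta.decays ![i, j]

theorem decays_bigXi (i : Fin 3) : Decays (2 + δ) fun x => bigXi g k x i :=
  D.bound_bigXi.decays ![i]

theorem decays_bigPi : Decays (2 + δ) (bigPi g k) := D.bound_bigPi.decays ![]

omit D in
theorem decays_upsilon (m : ℝ) : Decays 1 fun x => upsilon m x - 1 :=
  (Decays.inv_norm.const_mul (-(2 * m))).congr' (r₀ := 0) fun x _ => by rw [upsilon]; ring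

/-- The rate is only `1` because the Schwarzschild lapse `Υ^{-1/2}` itself differs from `1` at order
`m/r`. -/
theorem decays_lapse_sub_one (hδ : 0 < δ) : Decays 1 fun x => lapse g x - 1 :=
  ((D.decays_lapseCheck.mono (by linarith)).add
    ((decays_upsilon m).inv_sqrt_sub_one one_pos)).congr' (r₀ := 0) fun x _ => by
      rw [lapseCheck]; ring

theorem decays_lapse (hδ : 0 < δ) : Decays 0 (lapse g) :=
  (D.decays_lapse_sub_one hδ).bounded zero_le_one (.const 1)

theorem decays_hinv (h0 : 0 < r₀) (hδ : 0 < δ) (i l : Fin 3) :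
    Decays 0 fun x => hinv g x i l := by
  have H := D.isRadialMetric h0
  have hε : ∀ i j, ∀ᶠ x in Bornology.cobounded E3,
      |hmetric g x i j - roundMetric x i j| ≤ 1 / 6 := fun i j =>
    (D.decays_metric i j).eventually_abs_le (by linarith) (by norm_num)
  have hε' := eventually_all.2 fun i => eventually_all.2 (hε i)
  -- Absorption: by the resolvent identity with `|γ - γ⁽⁰⁾| ≤ 1/6`, the row sum `S` of `|γ^{ij}|`
  -- satisfies `S ≤ 3 (2 + S/6) = 6 + S/2`, hence `S ≤ 12`.
  refine Asymptotics.IsBigO.of_bound 12 ?_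
  filter_upwards [hε', eventually_exterior r₀] with x hx hxr
  have h1 : ∀ l, |hinv g x i l| ≤ 2 + (∑ j, |hinv g x i j|) * (1 / 6) := fun l => by
    have h2 : hinv g x i l = roundMetric x i l
        + -∑ j, hinv g x i j * (hmetric g x j l - roundMetric x j l) := by
      rw [← H.hinv_sub_roundMetric hxr]; ring
    rw [h2]
    refine (abs_add_le _ _).trans (add_le_add (abs_roundMetric_le x i l) ?_)
    rw [abs_neg, Finset.sum_mul]
    refine (Finset.abs_sum_le_sum_abs _ _).trans (Finset.sum_le_sum fun j _ => ?_)
    rw [abs_mul]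
    exact mul_le_mul_of_nonneg_left (hx j l) (abs_nonneg _)
  have h3 : ∑ j, |hinv g x i j| ≤ 12 := by
    have h10 := h1 0
    have h11 := h1 1
    have h12 := h1 2
    simp only [Fin.sum_univ_three] at *
    linarith
  simp only [neg_zero, Real.rpow_zero, norm_one, mul_one, Real.norm_eq_abs]
  exact (Finset.single_le_sum (f := fun j => |hinv g x i j|) (fun j _ => abs_nonneg _)
    (Finset.mem_univ l)).trans h3

theorem decays_hinv_sub (h0 : 0 < r₀) (hδ : 0 < δ) (i l : Fin 3) :
    Decays (1 + δ) fun x => hinv g x i l - roundMetric x i l := by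
  refine (Decays.const_mul (-1) (Decays.sum (s := Finset.univ) fun j _ =>
    (D.decays_hinv h0 hδ i j).bounded_mul (D.decays_metric j l))).congr' (r₀ := r₀) fun x hx => ?_
  rw [(D.isRadialMetric h0).hinv_sub_roundMetric hx]
  ring

/-- The area density of the spheres relative to the round one. -/
theorem decays_density (h0 : 0 < r₀) (hδ : 0 < δ) :
    Decays (1 + δ) fun x => (√(g x).det)⁻¹ * lapse g x - 1 := by
  have H := D.isRadialMetric h0
  have h := (Decays.det_one_add_sub_one
    (M := fun x => Matrix.of fun i j => hmetric g x i j - roundMetric x i j) (by linarith)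
    D.decays_metric).inv_sqrt_sub_one (by linarith)
  refine h.congr' (r₀ := r₀) fun x hx => ?_
  have hA := H.lapse_pos hx
  rw [H.det_eq hx, Real.sqrt_mul (sq_nonneg _), Real.sqrt_sq hA.le, mul_inv]
  field_simp

/-! ### Energy and center of mass -/

/-- The expansion of the ADM energy integrand. -/
theorem decays_adm (hm : 0 < m) (hr₀ : 2 * m < r₀) (hδ : 0 < δ) :
    Decays (2 + δ) fun x =>
      ‖x‖ * (∑ i, ∑ j, (pd i (fun y => g y i j) x - pd j (fun y => g y i i) x) * omega x j)
      + (∑ i, hmetric g x i i - 2) - 2 * ((upsilon m x)⁻¹ - 1) + 2 * (‖x‖ * trThetaCheck m g x) := by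
  have h0 : 0 < r₀ := by linarith
  have H := D.isRadialMetric h0
  have hs := (decays_upsilon m).sqrt_sub_one one_pos
  have hi := (decays_upsilon m).inv_sqrt_sub_one one_pos
  have hs0 : Decays 0 fun x => √(upsilon m x) := hs.bounded zero_le_one (.const 1)
  have hi0 : Decays 0 fun x => (√(upsilon m x))⁻¹ := hi.bounded zero_le_one (.const 1)
  have hA := D.decays_lapseCheck
  have hA0 := D.decays_lapse hδ
  have hφ : Decays (1 + δ) fun x => ‖x‖ * trThetaCheck m g x :=
    (Decays.norm.mul D.decays_trThetaCheck).mono (by linarith)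
  have hτ : Decays (1 + δ) fun x => ∑ i, (hmetric g x i i - roundMetric x i i) :=
    .sum fun i _ => D.decays_metric i i
  have hZ : Decays (2 + δ) fun x => ‖x‖ *
      ∑ i, ∑ j, (hinv g x i j - roundMetric x i j) * thetaHat g x i j :=
    (Decays.norm.mul (.sum fun i _ => .sum fun j _ =>
      (D.decays_hinv_sub h0 hδ i j).mul (D.decays_thetaHat i j))).mono (by linarith)
  -- This function is `â r tr θ - 2`, expanded around the Schwarzschild values, for which the
  -- product equals `2`.
  have hv : Decays (1 + δ) fun x => (√(upsilon m x))⁻¹ * (‖x‖ * trThetaCheck m g x)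
      + 2 * (√(upsilon m x) * lapseCheck m g x) + lapseCheck m g x * (‖x‖ * trThetaCheck m g x) :=
    ((hi0.bounded_mul hφ).add ((hs0.bounded_mul hA).const_mul 2)).add
      (hA.mul_bounded (hφ.mono (by linarith)))
  -- What remains after the leading terms cancel. With `A`, `φ/r` the perturbations of `â` and `tr
  -- θ`, `s = Υ^{1/2}`, `τ = ∑ γᵢᵢ - 2`, `v` the function of `hv` and `Z` that of `hZ`, it is `4(s⁻¹
  -- - s)A + 2A² - 2(s⁻¹ - 1)φ - 2Aφ - vτ + 2âZ`. Every term is a product of small factors; the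
  -- slowest pair a Schwarzschild factor `O(r⁻¹)` with a perturbation `O(r^{-1-δ})`.
  have hW := ((((((hi.sub hs).mul hA).mono (p := 2 + δ) (by linarith)).const_mul 4).add
    (((hA.mul hA).mono (p := 2 + δ) (by linarith)).const_mul 2)).sub
    ((((hi.mul hφ).mono (p := 2 + δ) (by linarith)).const_mul 2).add
      (((hA.mul hφ).mono (p := 2 + δ) (by linarith)).const_mul 2))).sub
    (((hv.mul hτ).mono (p := 2 + δ) (by linarith)).sub ((hA0.bounded_mul hZ).const_mul 2))
  refine hW.congr' (r₀ := r₀) fun x hx => ?_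
  have hr : 0 < ‖x‖ := h0.trans hx
  have hU : 0 < upsilon m x := by
    have hx' : r₀ < ‖x‖ := hx
    rw [upsilon, sub_pos, div_lt_one hr]
    linarith
  have hsp := Real.sqrt_pos.2 hU
  have hsq : (upsilon m x)⁻¹ = (√(upsilon m x))⁻¹ ^ 2 := by rw [inv_pow, Real.sq_sqrt hU.le]
  have hT : trTheta g x = trThetaCheck m g x + 2 * √(upsilon m x) / ‖x‖ := by
    rw [trThetaCheck]; ring
  have hL : lapse g x = lapseCheck m g x + (√(upsilon m x))⁻¹ := by rw [lapseCheck]; ring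
  rw [H.adm_integrand hx, H.sum_theta_eq hx, hT, hL, hsq, Finset.sum_sub_distrib,
    sum_roundMetric_self (H.ne_zero hx)]
  generalize √(upsilon m x) = s at *
  field_simp
  ring

end IsGaugedExteriorData

/-- The limit of weighted spherical integrals of a sum, if one summand decays. -/
theorem tendsto_pow_mul_sphereInt_of_eq {F f h : E3 → ℝ} {r₀ q L : ℝ} {p : ℕ} (h0 : 0 < r₀)
    (hf : ContinuousOn f (exterior r₀)) (hF : ContinuousOn F (exterior r₀))
    (hh : Decays q h) (hFh : ∀ x ∈ exterior r₀, F x = f x + h x) (hpq : (p : ℝ) < q)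
    (hL : Tendsto (fun r : ℝ => r ^ p * sphereInt f r) atTop (𝓝 L)) :
    Tendsto (fun r : ℝ => r ^ p * sphereInt F r) atTop (𝓝 L) := by
  -- Splitting the integral needs continuity of the error term, which is inherited from `F - f`.
  have hhc : ContinuousOn h (exterior r₀) :=
    (hF.sub hf).congr fun x hx => by
      change h x = F x - f x
      rw [hFh x hx]; ring
  have := hL.add (tendsto_pow_mul_sphereInt hpq hh)
  rw [add_zero] at this
  refine this.congr' ?_
  filter_upwards [eventually_gt_atTop r₀] with r hr
  have hr0 : 0 ≤ r := (h0.trans hr).le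
  rw [← mul_add, ← sphereInt_add hf hhc hr0 hr]
  congr 1
  refine (sphereInt_congr hr0 fun x hx => ?_).symm
  exact hFh x (by rw [exterior, Set.mem_ofPred_eq, hx]; exact hr)

/-- Integration by parts for the curl on round spheres. -/
theorem sphereInt_curl {ψ : E3 → Fin 3 → ℝ} {r₀ r : ℝ}
    (hψ : ∀ j, ContDiffOn ℝ 1 (fun x => ψ x j) (exterior r₀)) (h0 : 0 < r₀) (hr : r₀ < r)
    (i : Fin 3) :
    r * sphereInt (fun x => (∑ l, ∑ a, ∑ b, eps l a b * omega x l * pd a (fun y => ψ y b) x)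
      * omega x i) r = sphereInt (fun x => ∑ l, ∑ n, eps i l n * omega x l * ψ x n) r := by
  have hr0 : 0 < r := h0.trans hr
  have hw : ∀ j, ContDiffOn ℝ 1 (fun x => omega x j) (exterior r₀) := contDiffOn_omega h0
  have hf : ∀ b, ContDiffOn ℝ 1 (fun x => ψ x b * omega x i) (exterior r₀) :=
    fun b => (hψ b).mul (hw i)
  have hc : ∀ b p q, ContinuousOn (fun x => omega x p * pd q (fun y => ψ y b * omega y i) x
      - omega x q * pd p (fun y => ψ y b * omega y i) x) (exterior r₀) := fun b p q =>
    ((hw p).continuousOn.mul (continuousOn_pd (hf b) q)).sub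
      ((hw q).continuousOn.mul (continuousOn_pd (hf b) p))
  have hYc : ContinuousOn (fun x => ∑ l, ∑ n, eps i l n * omega x l * ψ x n) (exterior r₀) :=
    continuousOn_finsetSum _ fun l _ => continuousOn_finsetSum _ fun n _ =>
      (continuousOn_const.mul (hw l).continuousOn).mul (hψ n).continuousOn
  -- The operator `ε_{lab} ω_l ∂_a` is the rotation field about the axis `b`. Applied to `ψ_b ωᵢ` it
  -- integrates to zero, and the product rule leaves `curl · ωᵢ` plus `ψ_b` times the rotational
  -- derivative of `ωᵢ`, which is `-ε_{ilb} ω_l / r`.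
  have e0 := sphereInt_rot (hf 0) hr0 hr (a := 1) (b := 2) (by decide)
  have e1 := sphereInt_rot (hf 1) hr0 hr (a := 2) (b := 0) (by decide)
  have e2 := sphereInt_rot (hf 2) hr0 hr (a := 0) (b := 1) (by decide)
  have hYr : sphereInt (fun x => r⁻¹ * ∑ l, ∑ n, eps i l n * omega x l * ψ x n) r
      = r⁻¹ * sphereInt (fun x => ∑ l, ∑ n, eps i l n * omega x l * ψ x n) r :=
    integral_const_mul _ _
  have hYc' : ContinuousOn (fun x => r⁻¹ * ∑ l, ∑ n, eps i l n * omega x l * ψ x n)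
      (exterior r₀) := continuousOn_const.mul hYc
  have key := sphereInt_add (hc 0 1 2) ((hc 1 2 0).fun_add ((hc 2 0 1).fun_add hYc')) hr0.le hr
  rw [sphereInt_add (hc 1 2 0) ((hc 2 0 1).fun_add hYc') hr0.le hr,
    sphereInt_add (hc 2 0 1) hYc' hr0.le hr, e0, e1, e2, hYr, zero_add, zero_add, zero_add] at key
  rw [← mul_inv_cancel_left₀ hr0.ne' (sphereInt (fun x => ∑ l, ∑ n, _) r), ← key]
  congr 1
  refine sphereInt_congr hr0.le fun x hx => ?_
  have hxe : x ∈ exterior r₀ := by rw [exterior, Set.mem_ofPred_eq, hx]; exact hr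
  have hpd : ∀ q b, pd q (fun y => ψ y b * omega y i) x
      = ψ x b * (roundMetric x q i / r) + pd q (fun y => ψ y b) x * omega x i := fun q b => by
    rw [pd_mul q (differentiableAt_of_contDiffOn (hψ b) hxe)
      (differentiableAt_of_contDiffOn (hw i) hxe), pd_omega (ne_zero_of_mem_exterior h0 hxe), hx]
  simp only [hpd]
  fin_cases i <;> simp [Fin.sum_univ_three, eps, roundMetric, kron] <;> field_simp <;> ring

/-- The curl only sees the tangential part of the derivative. -/
theorem curl_eq_sum_roundDeriv (ψ : E3 → Fin 3 → ℝ) (x : E3) :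
    ∑ l, ∑ a, ∑ b, eps l a b * omega x l * pd a (fun y => ψ y b) x
      = ∑ l, ∑ i, ∑ j, eps l i j * omega x l * roundDeriv (tensor1 ψ) x ![i, j] := by
  have h1 : ∀ i j, roundDeriv (tensor1 ψ) x ![i, j]
      = ∑ a, ∑ b, roundMetric x i a * roundMetric x j b * pd a (fun y => ψ y b) x := fun i j => by
    rw [roundDeriv, ← (finTwoArrowEquiv (Fin 3)).symm.sum_comp, Fintype.sum_prod_type]
    simp [Fin.prod_univ_two, tensor1, Fin.tail]
  -- The `ω`-part of either projection meets `ε_{lij} ω_l` and vanishes by antisymmetry. The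
  -- normalization `|ω| = 1` plays no role.
  have h2 : ∀ a b, ∑ l, ∑ i, ∑ j, eps l i j * omega x l * (roundMetric x i a * roundMetric x j b)
      = ∑ l, eps l a b * omega x l := fun a b => by
    fin_cases a <;> fin_cases b <;>
      simp [Fin.sum_univ_three, eps, roundMetric, kron] <;> ring
  set p : Fin 3 → Fin 3 → ℝ := fun a b => pd a (fun y => ψ y b) x
  calc ∑ l, ∑ a, ∑ b, eps l a b * omega x l * p a b
      = ∑ a, ∑ b, (∑ l, eps l a b * omega x l) * p a b := by
        simp only [Fin.sum_univ_three]; ring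
    _ = ∑ a, ∑ b, (∑ l, ∑ i, ∑ j, eps l i j * omega x l
          * (roundMetric x i a * roundMetric x j b)) * p a b := by simp only [h2]
    _ = ∑ a, ∑ b, ∑ l, ∑ i, ∑ j, eps l i j * omega x l
          * (roundMetric x i a * roundMetric x j b * p a b) := by
        simp only [Finset.sum_mul, mul_assoc]
    _ = _ := by
        simp only [h1, Finset.mul_sum]
        simp only [← Fintype.sum_prod_type']
        refine Finset.sum_nbij' (fun t => (t.2.2.1, t.2.2.2.1, t.2.2.2.2, t.1, t.2.1))
          (fun t => (t.2.2.2.1, t.2.2.2.2, t.1, t.2.1, t.2.2.1)) ?_ ?_ ?_ ?_ ?_ <;> simp [p]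

/-! ### Evaluation of the four ADM charges -/

namespace IsGaugedExteriorData

variable {m r₀ δ : ℝ} {c b a : Fin 3 → ℝ} {g k : E3 → Matrix (Fin 3) (Fin 3) ℝ}

theorem upsilon_pos (hm : 0 < m) (hr₀ : 2 * m < r₀) {x : E3} (hx : x ∈ exterior r₀) :
    0 < upsilon m x := by
  have hx' : r₀ < ‖x‖ := hx
  rw [upsilon, sub_pos, div_lt_one (by linarith)]
  linarith

theorem continuousOn_upsilon (hm : 0 < m) (hr₀ : 2 * m < r₀) :
    ContinuousOn (upsilon m) (exterior r₀) :=
  continuousOn_const.sub (continuousOn_const.div continuous_norm.continuousOn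
    fun x hx => ((by linarith : (0 : ℝ) < r₀).trans hx).ne')

theorem hasADMEnergy (hm : 0 < m) (hr₀ : 2 * m < r₀) (hδ : 0 < δ)
    (D : IsGaugedExteriorData m r₀ δ c b a g k) : HasADMEnergy g m := by
  have h0 : 0 < r₀ := by linarith
  have H := D.isRadialMetric h0
  have hIc : ContinuousOn (fun x => ∑ i, ∑ j,
      (pd i (fun y => g y i j) x - pd j (fun y => g y i i) x) * omega x j) (exterior r₀) :=
    continuousOn_finsetSum _ fun i _ => continuousOn_finsetSum _ fun j _ =>
      ((H.continuousOn_pd_metric i i j).sub (H.continuousOn_pd_metric j i i)).mul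
        (contDiffOn_omega (n := 1) h0 j).continuousOn
  have hUc := continuousOn_upsilon hm hr₀
  have hfc : ContinuousOn (fun x => 2 * ((upsilon m x)⁻¹ - 1) / ‖x‖) (exterior r₀) :=
    (continuousOn_const.mul ((hUc.inv₀ fun x hx => (upsilon_pos hm hr₀ hx).ne').sub
      continuousOn_const)).div continuous_norm.continuousOn fun x hx => (h0.trans hx).ne'
  have hτ : Decays (1 + δ) fun x => ∑ i, (hmetric g x i i - roundMetric x i i) :=
    .sum fun i _ => D.decays_metric i i
  have hφ : Decays (1 + δ) fun x => ‖x‖ * trThetaCheck m g x :=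
    (Decays.norm.mul D.decays_trThetaCheck).mono (by linarith)
  -- Dividing `decays_adm` by `r` makes the trace of `γ` and the `tr θ` perturbation of order
  -- `r^{-2-δ}`, negligible against the weight `r²`.
  have hE := (Decays.inv_norm.mul (((D.decays_adm hm hr₀ hδ).mono (p := 1 + δ) (by linarith)).sub
    (hτ.add (hφ.const_mul 2)))).mono (p := 2 + δ) (by linarith)
  -- Because `Υ⁻¹ - 1 = 2m/(r - 2m)`, the weighted integral equals `16πm (1 - 2m/r)⁻¹` exactly.
  have hlim : Tendsto (fun r : ℝ => r ^ 2 * sphereInt (fun x => 2 * ((upsilon m x)⁻¹ - 1) / ‖x‖) r)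
      atTop (𝓝 (16 * Real.pi * m)) := by
    have h1 : Tendsto (fun r : ℝ => 16 * Real.pi * m * (1 - 2 * m / r)⁻¹) atTop
        (𝓝 (16 * Real.pi * m * (1 - 0)⁻¹)) :=
      ((tendsto_const_nhds.sub (tendsto_const_nhds.div_atTop tendsto_id)).inv₀
        (by norm_num)).const_mul _
    rw [sub_zero, inv_one, mul_one] at h1
    refine h1.congr' ?_
    filter_upwards [eventually_gt_atTop r₀] with r hr
    have hr0 : 0 < r := h0.trans hr
    have h2 := sphereInt_radial_mul (fun r => 2 * ((1 - 2 * m / r)⁻¹ - 1) / r) (fun _ => 1) hr0.le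
    simp only [mul_one, sphereInt_const] at h2
    simp only [upsilon]
    rw [h2]
    have h3 : r - 2 * m ≠ 0 := by linarith
    have h4 : (1 - 2 * m / r)⁻¹ = r / (r - 2 * m) := by
      rw [one_sub_div hr0.ne', inv_div]
    rw [h4, div_sub_one h3, sub_sub_cancel]
    field_simp
    ring
  have := (tendsto_pow_mul_sphereInt_of_eq h0 hfc hIc hE (fun x hx => by
    have hr : ‖x‖ ≠ 0 := (h0.trans hx).ne'
    rw [Finset.sum_sub_distrib, sum_roundMetric_self (H.ne_zero hx)]
    field_simp
    ring) (by push_cast; linarith) hlim).const_mul (1 / (16 * Real.pi))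
  have hpi := Real.pi_pos
  have e : 1 / (16 * Real.pi) * (16 * Real.pi * m) = m := by field_simp
  rwa [e] at this

/-- With `g ω = â² ω` and `tr g = â² + ∑ γᵢᵢ`, the undifferentiated terms contribute `(1 - â²) + (â²
+ ∑ γᵢᵢ - 3) = ∑ γᵢᵢ - 2`, so the lapse cancels. The result is the combination that `decays_adm`
expands, and no condition on the `ℓ = 1` mode of the trace of `γ` is needed. -/
theorem center_integrand (h0 : 0 < r₀) (D : IsGaugedExteriorData m r₀ δ c b a g k) {x : E3}
    (hx : x ∈ exterior r₀) (i : Fin 3) :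
    ∑ j, (x i * (∑ l, (pd l (fun y => g y l j) x - pd j (fun y => g y l l) x))
      - ((g x i j - kron i j) - kron i j * ∑ l, (g x l l - kron l l))) * omega x j
      = (‖x‖ * (∑ i, ∑ j, (pd i (fun y => g y i j) x - pd j (fun y => g y i i) x) * omega x j)
        + (∑ i, hmetric g x i i - 2)) * omega x i := by
  have H := D.isRadialMetric h0
  have hr : ‖x‖ ≠ 0 := (h0.trans hx).ne'
  have hxi : x i = ‖x‖ * omega x i := by rw [omega]; field_simp
  have h1 : ∑ i, ∑ j, (pd i (fun y => g y i j) x - pd j (fun y => g y i i) x) * omega x j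
      = ∑ j, (∑ l, (pd l (fun y => g y l j) x - pd j (fun y => g y l l) x)) * omega x j := by
    rw [Finset.sum_comm]
    simp only [Finset.sum_mul]
  have h2 := H.radial x hx i
  have h3 := sum_kron_mul i (omega x)
  have h4 : ∑ l, (g x l l - kron l l) = lapse g x ^ 2 + ∑ l, hmetric g x l l - 3 := by
    have := sum_omega_sq (H.ne_zero hx)
    simp only [hmetric, normalDown, kron, Fin.sum_univ_three, if_true] at this ⊢
    linear_combination lapse g x ^ 2 * this
  rw [h1, h4, hxi]
  generalize ∑ l, hmetric g x l l = T
  generalize hq : (fun j => ∑ l, (pd l (fun y => g y l j) x - pd j (fun y => g y l l) x)) = q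
  have hq' : ∀ j, ∑ l, (pd l (fun y => g y l j) x - pd j (fun y => g y l l) x) = q j :=
    congrFun hq
  simp only [hq', Fin.sum_univ_three] at h2 h3 ⊢
  linear_combination -h2 + (lapse g x ^ 2 + T - 2) * h3

theorem hasADMCenterOfMass (hm : 0 < m) (hr₀ : 2 * m < r₀) (hδ : 0 < δ)
    (D : IsGaugedExteriorData m r₀ δ c b a g k) (i : Fin 3) :
    HasADMCenterOfMass m g i (-(1 / (8 * Real.pi * m)) * c i) := by
  have h0 : 0 < r₀ := by linarith
  have H := D.isRadialMetric h0
  have hwc : ∀ j, ContinuousOn (fun x => omega x j) (exterior r₀) := fun j =>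
    (contDiffOn_omega (n := 1) h0 j).continuousOn
  have hgc : ∀ i j, ContinuousOn (fun x => g x i j) (exterior r₀) := fun i j =>
    (H.contDiff i j).continuousOn
  have hxc : ContinuousOn (fun x : E3 => x i) (exterior r₀) := by fun_prop
  have hIc : ContinuousOn (fun x =>
      ∑ j, (x i * (∑ l, (pd l (fun y => g y l j) x - pd j (fun y => g y l l) x))
      - ((g x i j - kron i j) - kron i j * ∑ l, (g x l l - kron l l))) * omega x j)
      (exterior r₀) :=
    continuousOn_finsetSum _ fun j _ => ((hxc.mul (continuousOn_finsetSum _ fun l _ =>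
      (H.continuousOn_pd_metric l l j).sub (H.continuousOn_pd_metric j l l))).sub
      (((hgc i j).sub continuousOn_const).sub (continuousOn_const.mul
        (continuousOn_finsetSum _ fun l _ => (hgc l l).sub continuousOn_const)))).mul (hwc j)
  have hUc := continuousOn_upsilon hm hr₀
  have hU1 : ContinuousOn (fun x => 2 * ((upsilon m x)⁻¹ - 1) * omega x i) (exterior r₀) :=
    (continuousOn_const.mul ((hUc.inv₀ fun x hx => (upsilon_pos hm hr₀ hx).ne').sub
      continuousOn_const)).mul (hwc i)
  have hθc : ContinuousOn (trThetaCheck m g) (exterior r₀) :=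
    H.continuousOn_trTheta.sub ((continuousOn_const.mul hUc.sqrt).div
      continuous_norm.continuousOn fun x hx => (h0.trans hx).ne')
  have hφc : ContinuousOn (fun x => -2 * ‖x‖ * (trThetaCheck m g x * omega x i)) (exterior r₀) :=
    (continuousOn_const.mul continuous_norm.continuousOn).mul (hθc.mul (hwc i))
  have hE := (D.decays_adm hm hr₀ hδ).mul_bounded (Decays.omega i)
  -- The Schwarzschild term is radial times `ωᵢ` and integrates to zero. The factor `‖x‖` raises the
  -- weight `r²` to the `r³` of the limit defining `c i`.
  have hlim : Tendsto (fun r : ℝ => r ^ 2 * sphereInt (fun x =>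
      2 * ((upsilon m x)⁻¹ - 1) * omega x i + -2 * ‖x‖ * (trThetaCheck m g x * omega x i)) r)
      atTop (𝓝 (-2 * c i)) := by
    refine ((D.lim_trTheta i).const_mul (-2)).congr' ?_
    filter_upwards [eventually_gt_atTop r₀] with r hr
    have hr0 : 0 < r := h0.trans hr
    have e1 := sphereInt_radial_mul (fun r => 2 * ((1 - 2 * m / r)⁻¹ - 1)) (fun x => omega x i)
      hr0.le
    have e2 := sphereInt_radial_mul (fun r => -2 * r) (fun x => trThetaCheck m g x * omega x i)
      hr0.le
    rw [sphereInt_add hU1 hφc hr0.le hr, e2]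
    simp only [upsilon]
    rw [e1, sphereInt_omega, ellOne]
    ring
  have := (tendsto_pow_mul_sphereInt_of_eq h0 (hU1.add hφc) hIc hE (fun x hx => by
    rw [D.center_integrand h0 hx]
    simp only [Pi.add_apply]
    ring) (by push_cast; linarith) hlim).const_mul (1 / (16 * Real.pi * m))
  have hpi := Real.pi_pos
  have e : 1 / (16 * Real.pi * m) * (-2 * c i) = -(1 / (8 * Real.pi * m)) * c i := by
    field_simp; ring
  rwa [e] at this

/-- The flux integrand and `-tr Θ ωᵢ` are each `O(r^{-2-δ})`, so the comparison requires no
cancellation. At this decay rate both limits are in fact zero. -/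
theorem hasADMLinearMomentum (h0 : 0 < r₀) (hδ : 0 < δ)
    (D : IsGaugedExteriorData m r₀ δ c b a g k) (i : Fin 3) :
    HasADMLinearMomentum g k i (-(1 / (8 * Real.pi)) * b i) := by
  have H := D.isRadialMetric h0
  have hwc : ∀ j, ContinuousOn (fun x => omega x j) (exterior r₀) := fun j =>
    (contDiffOn_omega (n := 1) h0 j).continuousOn
  have hIc : ContinuousOn (fun x => ∑ j, (k x i j - (∑ a, k x a a) * g x i j) * omega x j)
      (exterior r₀) :=
    continuousOn_finsetSum _ fun j _ => ((D.contDiff_k i j).continuousOn.sub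
      ((continuousOn_finsetSum _ fun a _ => (D.contDiff_k a a).continuousOn).mul
        (H.contDiff i j).continuousOn)).mul (hwc j)
  have hfc : ContinuousOn (fun x => -1 * (trBigTheta g k x * omega x i)) (exterior r₀) :=
    continuousOn_const.mul ((H.continuousOn_trBigTheta D.contDiff_k).mul (hwc i))
  have hA0 := D.decays_lapse hδ
  have hA2 : Decays 0 fun x => lapse g x * lapse g x := hA0.mul_bounded hA0
  have hT : Decays (2 + δ) (trBigTheta g k) := .sum fun i _ => .sum fun j _ =>
    (D.decays_hinv h0 hδ i j).bounded_mul (D.decays_bigTheta i j)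
  have hE := ((hA0.bounded_mul (D.decays_bigXi i)).add ((hA2.bounded_mul
    ((D.decays_bigPi.mul_bounded ((Decays.const 1).sub hA2)).sub
      (.sum (s := Finset.univ) fun a _ => D.decays_bigTheta a a))).mul_bounded
      (Decays.omega i))).add (hT.mul_bounded (Decays.omega i))
  have hlim : Tendsto (fun r : ℝ => r ^ 2 * sphereInt (fun x =>
      -1 * (trBigTheta g k x * omega x i)) r) atTop (𝓝 (-1 * b i)) := by
    refine ((D.lim_trBigTheta i).const_mul (-1)).congr fun r => ?_
    have : sphereInt (fun x => -1 * (trBigTheta g k x * omega x i)) r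
      = -1 * ellOne i (trBigTheta g k) r := integral_const_mul _ _
    rw [this]
    ring
  have := (tendsto_pow_mul_sphereInt_of_eq h0 hfc hIc hE (fun x hx => by
    rw [H.momentum_integrand hx (D.symm_k x hx)]
    ring) (by push_cast; linarith) hlim).const_mul (1 / (8 * Real.pi))
  have e : 1 / (8 * Real.pi) * (-1 * b i) = -(1 / (8 * Real.pi)) * b i := by ring
  rwa [e] at this

theorem hasADMAngularMomentum (h0 : 0 < r₀) (hδ : 0 < δ)
    (D : IsGaugedExteriorData m r₀ δ c b a g k) (i : Fin 3) :
    HasADMAngularMomentum g k i (1 / (8 * Real.pi) * a i) := by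
  have H := D.isRadialMetric h0
  have hwc : ∀ j, ContinuousOn (fun x => omega x j) (exterior r₀) := fun j =>
    (contDiffOn_omega (n := 1) h0 j).continuousOn
  have hxc : ∀ l, ContinuousOn (fun x : E3 => x l) (exterior r₀) := fun l => by fun_prop
  have hΞ := H.contDiffOn_bigXi D.contDiff_k
  have hIc : ContinuousOn (fun x => ∑ j, ∑ l, ∑ n,
      eps i l n * x l * (k x n j - (∑ a, k x a a) * g x n j) * omega x j) (exterior r₀) :=
    continuousOn_finsetSum _ fun j _ => continuousOn_finsetSum _ fun l _ =>
      continuousOn_finsetSum _ fun n _ => ((continuousOn_const.mul (hxc l)).mul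
        ((D.contDiff_k n j).continuousOn.sub ((continuousOn_finsetSum _ fun a _ =>
          (D.contDiff_k a a).continuousOn).mul (H.contDiff n j).continuousOn))).mul (hwc j)
  have hYc : ContinuousOn (fun x => ‖x‖ * ∑ l, ∑ n, eps i l n * omega x l * bigXi g k x n)
      (exterior r₀) :=
    continuous_norm.continuousOn.mul (continuousOn_finsetSum _ fun l _ =>
      continuousOn_finsetSum _ fun n _ =>
        (continuousOn_const.mul (hwc l)).mul (hΞ n).continuousOn)
  have hY : Decays (2 + δ) fun x => ∑ l, ∑ n, eps i l n * omega x l * bigXi g k x n :=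
    .sum fun l _ => .sum fun n _ =>
      ((Decays.const _).bounded_mul (Decays.omega l)).bounded_mul (D.decays_bigXi n)
  -- Replacing `â` by `1` costs `r · r⁻¹ · r^{-2-δ}`, just enough for the weight `r²`.
  have hE := ((Decays.norm.mul (D.decays_lapse_sub_one hδ)).mul hY).mono (p := 2 + δ) (by linarith)
  set curl : E3 → ℝ := fun x =>
    ∑ l, ∑ p, ∑ q, eps l p q * omega x l * pd p (fun y => bigXi g k y q) x with hcu
  have hcc : ContinuousOn curl (exterior r₀) :=
    continuousOn_finsetSum _ fun l _ => continuousOn_finsetSum _ fun p _ =>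
      continuousOn_finsetSum _ fun q _ =>
        (continuousOn_const.mul (hwc l)).mul (continuousOn_pd (hΞ q) p)
  -- Only horizontal derivatives of `Ξ` are controlled, so the curl is first rewritten through
  -- `roundDeriv`.
  have hcd : Decays (3 + δ) curl := by
    have h1 : ∀ p q, Decays (3 + δ) fun x => roundDeriv (tensor1 (bigXi g k)) x ![p, q] :=
      fun p q => (HorizontalO.decays D.bound_bigXi.2 ![p, q]).mono (by linarith)
    refine Decays.congr' (r₀ := r₀) (.sum (s := Finset.univ) fun l _ =>
      .sum (s := Finset.univ) fun p _ => .sum (s := Finset.univ) fun q _ =>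
      ((Decays.const (eps l p q)).bounded_mul (Decays.omega l)).bounded_mul (h1 p q)) fun x _ => ?_
    rw [hcu]
    exact curl_eq_sum_roundDeriv _ _
  -- The two curls differ by `(â/√det g - 1) curl = O(r^{-4-2δ})`, which beats the weight `r⁴`.
  have hE' := (((D.decays_density h0 hδ).mul hcd).mul_bounded (Decays.omega i)).const_mul (-1)
  have hHc : ContinuousOn (fun x => hcurl g (bigXi g k) x * omega x i) (exterior r₀) :=
    (H.continuousOn_hcurl hΞ).mul (hwc i)
  have hlim4 : Tendsto (fun r : ℝ => r ^ 4 * sphereInt (fun x => curl x * omega x i) r) atTop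
      (𝓝 (a i)) :=
    tendsto_pow_mul_sphereInt_of_eq h0 hHc (hcc.mul (hwc i)) hE' (fun x hx => by
      have h1 : hcurl g (bigXi g k) x = (√(g x).det)⁻¹ * lapse g x * curl x := H.hcurl_eq hx _
      rw [h1]
      ring) (by push_cast; linarith) (D.lim_curlXi i)
  -- One power of `r` comes from the factor `‖x‖` and one from the integration by parts, which
  -- accounts for `r⁴` in the curl limit.
  have hlim : Tendsto (fun r : ℝ => r ^ 2 * sphereInt (fun x =>
      ‖x‖ * ∑ l, ∑ n, eps i l n * omega x l * bigXi g k x n) r) atTop (𝓝 (a i)) := by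
    refine hlim4.congr' ?_
    filter_upwards [eventually_gt_atTop r₀] with r hr
    have hr0 : 0 < r := h0.trans hr
    rw [sphereInt_radial_mul (fun r => r) _ hr0.le, ← sphereInt_curl hΞ h0 hr i]
    ring
  have := (tendsto_pow_mul_sphereInt_of_eq h0 hYc hIc hE (fun x hx => by
    rw [H.angular_integrand hx (D.symm_k x hx)]
    ring) (by push_cast; linarith) hlim).const_mul (1 / (8 * Real.pi))
  exact this

end IsGaugedExteriorData

end HorizontalConstraint

end

theorem mainTheorem3 (m r₀ δ : ℝ) (hm : 0 < m) (hr₀ : 2 * m < r₀) (hδ : 0 < δ)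
    (c b a : Fin 3 → ℝ)
    (g k : HorizontalConstraint.E3 → Matrix (Fin 3) (Fin 3) ℝ)
    (hgk : HorizontalConstraint.IsGaugedExteriorData m r₀ δ c b a g k) :
    HorizontalConstraint.HasADMEnergy g m ∧
    ∀ i : Fin 3,
      HorizontalConstraint.HasADMCenterOfMass m g i (-(1 / (8 * Real.pi * m)) * c i) ∧
      HorizontalConstraint.HasADMLinearMomentum g k i (-(1 / (8 * Real.pi)) * b i) ∧
      HorizontalConstraint.HasADMAngularMomentum g k i (1 / (8 * Real.pi) * a i) := by
  have h0 : 0 < r₀ := by linarith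
  exact ⟨hgk.hasADMEnergy hm hr₀ hδ, fun i => ⟨hgk.hasADMCenterOfMass hm hr₀ hδ i,
    hgk.hasADMLinearMomentum h0 hδ i, hgk.hasADMAngularMomentum h0 hδ i⟩⟩
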